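/- **Setting.** Let $\mathcal H$ be a separable complex Hilbert space. Consider for $0\le\tau\le t$ the Markov master equation $$\partial_t P_{\tau,t}(B)=\mathcal L_t(P_{\tau,t}(B)),\quad P_{\tau,\tau}(B)=B,\qquad \mathcal L_t(B)=\Phi_t(B)-G_t^*B-BG_t,\quad G_t=\tfrac12\Phi_t(I)+iH_t,$$ with $H_t$ symmetric. Here $\Lambda$ is a positive self-adjoint operator and $\Phi_t$ $(t\ge0)$ are unbounded completely positive maps given, for bounded $X$, by the forms $\Phi_t(X)[\varphi,\psi]=\langle\Lambda^{1/2}\varphi,A_t(X)\Lambda^{1/2}\psi\rangle$ on $\operatorname{dom}\Lambda^{1/2}$, where $A_t=\Lambda^{-1/2}\Phi_t(\cdot)\Lambda^{-1/2}$ is a bounded normal completely positive map on $\mathcal B(\mathcal H)$; write $\Phi_t(X)[\psi]=\Phi_t(X)[\psi,\psi]$. **Domain and continuity conditions.** 1. $I\le\Phi_t(I)\le\Lambda$ as forms on $\operatorname{dom}\Lambda^{1/2}$, and $t\mapsto A_t(X)$ is ultraweakly continuous on $[0,\infty)$ for every $X\in\mathcal B(\mathcal H)$. 2. The $G_t$ are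 densely defined closed operators with a joint core $\mathcal D$ such that $\mathcal D\subseteq\operatorname{dom}G_t^N$ for all $t\ge 0$, for some $N\ge2$, and $\mathcal D\subseteq\operatorname{dom}\Lambda^{1/2}$. On $\mathcal D$, $G_t^*+G_t=\Phi_t(I)$, that is, $\langle G_t\varphi,\psi\rangle+\langle\varphi,G_t\psi\rangle=\Phi_t(I)[\varphi,\psi]$ for $\varphi,\psi\in\mathcal D$; and the form $\Phi_t(I)[\cdot]$ on $\mathcal D$ is closable (it is the form of a positive self-adjoint operator). 3. $W_{s,t}$ $(0\le s\le t)$ is a strongly continuous evolution system of contractions: $W_{t,t}=I$, $W_{s,r}W_{r,t}=W_{s,t}$, with $W_{s,t}\mathcal D\subseteq\mathcal D$ and, for $\psi\in\mathcal D$, $\partial_tW_{s,t}\psi=-W_{s,t}G_t\psi$, $\partial_sW_{s,t}\psi=G_sW_{s,t}\psi$. 4. For $\psi\in\mathcal D$ the vectors $\Lambda^{1/2}W_{s,t}\psi$ are square integrable in $s\in[0,t]$ and norm continuous in $t\in[s,\infty)$. 5. There is a Kraus decomposition $A_t(X)=\sum_kA_k(t)^*XA_k(t)$ such that, with $\Phi_k(t)=A_k(t)\Lambda^{1/2}$,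 one has $\mathcal D\subseteq\operatorname{dom}\Lambda^{1/2}\Phi_k(t)$, and for $\psi\in\mathcal D$ the vectors $\Lambda^{1/2}\Phi_k(s)W_{s,t}\psi$ are square integrable in $s\in[0,t]$ and norm continuous in $t\in[s,\infty)$. **Minimal solutions.** Let $V_{s,t}(B)=W_{s,t}^*BW_{s,t}$. For $\lambda\in(0,1]$ put $P^{(\lambda,0)}_{\tau,t}(B)=V_{\tau,t}(B)$ and $$P^{(\lambda,n+1)}_{\tau,t}(B)=V_{\tau,t}(B)+\lambda\int_\tau^t ds\,V_{s,t}\Phi_sP^{(\lambda,n)}_{\tau,s}(B),$$ where the integral is the bounded operator of the form $\psi\mapsto\int_\tau^t\Phi_s\bigl(P^{(\lambda,n)}_{\tau,s}(B)\bigr)[W_{s,t}\psi]\,ds$ on $\mathcal D$. For bounded $B\ge0$ the least upper bound over $n$ is denoted by $P^{(\lambda)}_{\tau,t}(B)$; it is the minimal solution for the regularized generator $\lambda\Phi_t(B)-G_t^*B-BG_t$. The minimal solution of the master equation is $P^{\min}=P^{(1)}$. At the unbounded positive operator $\Phi_s(I)$ the value of $P^{(\lambda)}_{s,t}$ is the positive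 form $$P^{(\lambda)}_{s,t}\Phi_s(I)[\psi]=\sup\{\langle\psi,P^{(\lambda)}_{s,t}(X)\psi\rangle:\ 0\le X\in\mathcal B(\mathcal H),\ X\le\Phi_s(I)\text{ on }\mathcal D\}\in[0,\infty].$$ **Theorem 1.2.** Assume the domain and continuity conditions, and let $0\le\tau\le t$. If the operator $$\widehat C=\int_0^1d\lambda\int_\tau^tds\,P^{(\lambda)}_{s,t}\Phi_s(I)$$ is densely defined, in the sense that the set of all $\psi\in\mathcal H$ with $\widehat C[\psi]=\int_0^1d\lambda\int_\tau^tds\,P^{(\lambda)}_{s,t}\Phi_s(I)[\psi]<\infty$ is dense in $\mathcal H$, then the minimal solution is unital: $P^{\min}_{\tau,t}(I)=I$. -/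

import Mathlib

open MeasureTheory Set Filter Topology
open scoped ENNReal ComplexOrder CStarAlgebra

noncomputable section

namespace MasterEquation

variable {H : Type*} [NormedAddCommGroup H] [InnerProductSpace ℂ H]

/-! ### Unbounded operators and forms -/

/-- The value `T x` of a partially defined operator; the junk value `0` off the domain is never
used below, since membership in the domain is always required separately. -/
def pApply (T : H →ₗ.[ℂ] H) (x : H) : H := by
  classical exact if h : x ∈ T.domain then T ⟨x, h⟩ else 0

/-- `T` is a positive self-adjoint operator (self-adjointness forces the domain to be dense). -/
structure IsPosSelfAdjoint [CompleteSpace H] (T : H →ₗ.[ℂ] H) : Prop where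
  selfAdjoint : IsSelfAdjoint T
  nonneg : ∀ x ∈ T.domain, 0 ≤ (inner ℂ x (pApply T x)).re

/-- `S = T ^ (1 / 2)`: `S` is the (unique) positive self-adjoint operator with `S ∘ S = T`, domains
included. -/
structure IsPosSqrt [CompleteSpace H] (S T : H →ₗ.[ℂ] H) : Prop where
  pos : IsPosSelfAdjoint S
  comp_self : ∀ x y : H, (x, y) ∈ T.graph ↔ ∃ z : H, (x, z) ∈ S.graph ∧ (z, y) ∈ S.graph

/-- The domain of the power `T ^ n` of an unbounded operator. -/
def powDomain (T : H →ₗ.[ℂ] H) : ℕ → Set H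
  | 0 => univ
  | n + 1 => {x | x ∈ T.domain ∧ pApply T x ∈ powDomain T n}

/-- The quadratic form `q`, considered on the subspace `D`, is closable. -/
def FormClosable (D : Submodule ℂ H) (q : H → ℝ) : Prop :=
  ∀ u : ℕ → H, (∀ n, u n ∈ D) → Tendsto u atTop (𝓝 0) →
    Tendsto (fun p : ℕ × ℕ => q (u p.1 - u p.2)) atTop (𝓝 0) →
    Tendsto (fun n => q (u n)) atTop (𝓝 0)

/-- The bounded operator of a bounded quadratic form `q` given on the subspace `D`. It is unique
when `D` is dense. -/
def formOp (D : Submodule ℂ H) (q : H → ℂ) : H →L[ℂ] H := by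
  classical exact
    if h : ∃ T : H →L[ℂ] H, ∀ ψ ∈ D, inner ℂ ψ (T ψ) = q ψ then h.choose else 0

/-- The ultraweak topology of `B(H)`: the coarsest topology for which all the functionals
`X ↦ ∑ₖ ⟪ξₖ, X ηₖ⟫` with square-summable `(ξₖ)`, `(ηₖ)` are continuous. -/
@[reducible] def ultraweak (H : Type*) [NormedAddCommGroup H] [InnerProductSpace ℂ H] :
    TopologicalSpace (H →L[ℂ] H) :=
  ⨅ (ξ : ℕ → H) (η : ℕ → H) (_ : Summable fun k => ‖ξ k‖ ^ 2)
    (_ : Summable fun k => ‖η k‖ ^ 2),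
    TopologicalSpace.induced (fun X : H →L[ℂ] H => ∑' k, inner ℂ (ξ k) (X (η k))) inferInstance

variable [CompleteSpace H]

/-! ### The coefficients of the master equation -/

/-- The objects that enter the master equation. Times are the `t ≥ 0`, and `W s t` is relevant for
`0 ≤ s ≤ t` only.

* `Λ` dominates `Φ_t(I)`, and `rootΛ` is `Λ ^ (1 / 2)`;
* `A t` is the completely positive map `Λ ^ (-1 / 2) Φ_t(·) Λ ^ (-1 / 2)`, so that it determines the
  unbounded completely positive map `Φ_t`, see `Coefficients.Φ`;
* `G t` are the generators, and `W s t` is the evolution system generated by them;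
* `D` is the joint core. -/
structure Coefficients (H : Type*) [NormedAddCommGroup H] [InnerProductSpace ℂ H]
    [CompleteSpace H] where
  Λ : H →ₗ.[ℂ] H
  rootΛ : H →ₗ.[ℂ] H
  A : ℝ → ((H →L[ℂ] H) →CP (H →L[ℂ] H))
  G : ℝ → (H →ₗ.[ℂ] H)
  W : ℝ → ℝ → (H →L[ℂ] H)
  D : Submodule ℂ H

namespace Coefficients

variable (E : Coefficients H)

/-- The unbounded completely positive map `Φ_t`: for bounded `X`, `Φ_t(X)` is the sesquilinear form
`Φ_t(X)[φ, ψ] = ⟪Λ ^ (1 / 2) φ, A_t(X) Λ ^ (1 / 2) ψ⟫` on the domain of `Λ ^ (1 / 2)`. -/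
def Φ (t : ℝ) (X : H →L[ℂ] H) (φ ψ : H) : ℂ :=
  inner ℂ (pApply E.rootΛ φ) (E.A t X (pApply E.rootΛ ψ))

/-- `V_{s,t}(B) = W_{s,t}^* B W_{s,t}`. -/
def V (s t : ℝ) (B : H →L[ℂ] H) : H →L[ℂ] H :=
  ContinuousLinearMap.adjoint (E.W s t) ∘L B ∘L E.W s t

/-- The domain and continuity conditions. -/
structure DomainContinuity : Prop where
  /-- `Λ` is positive self-adjoint and `rootΛ` is its positive square root. -/
  Λ_pos : IsPosSelfAdjoint E.Λ
  rootΛ_sqrt : IsPosSqrt E.rootΛ E.Λ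
  /-- `I ≤ Φ_t(I) ≤ Λ`. -/
  one_le_Φ : ∀ t, 0 ≤ t → ∀ ψ ∈ E.rootΛ.domain, ‖ψ‖ ^ 2 ≤ (E.Φ t 1 ψ ψ).re
  Φ_le_Λ : ∀ t, 0 ≤ t → ∀ ψ ∈ E.rootΛ.domain, (E.Φ t 1 ψ ψ).re ≤ ‖pApply E.rootΛ ψ‖ ^ 2
  /-- The maps `A_t` are normal, and ultraweakly continuous in `t`. -/
  A_normal : ∀ t, 0 ≤ t →
    @Continuous (H →L[ℂ] H) (H →L[ℂ] H) (ultraweak H) (ultraweak H) (E.A t)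
  A_continuous : ∀ X : H →L[ℂ] H,
    @ContinuousOn ℝ (H →L[ℂ] H) inferInstance (ultraweak H) (fun t => E.A t X) (Ici 0)
  /-- The `G_t` are densely defined closed operators with the joint core `D`. -/
  G_dense : ∀ t, 0 ≤ t → Dense ((E.G t).domain : Set H)
  G_closed : ∀ t, 0 ≤ t → (E.G t).IsClosed
  G_core : ∀ t, 0 ≤ t → (E.G t).HasCore E.D
  /-- `D` is contained in the domains of the powers `G_t ^ N` for some `N ≥ 2`. -/
  D_le_pow : ∃ N : ℕ, 2 ≤ N ∧ ∀ t, 0 ≤ t → (E.D : Set H) ⊆ powDomain (E.G t) N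
  /-- `W` is a strongly continuous contractive evolution system. -/
  W_contract : ∀ s t, 0 ≤ s → s ≤ t → ‖E.W s t‖ ≤ 1
  W_self : ∀ t, 0 ≤ t → E.W t t = 1
  W_comp : ∀ s r t, 0 ≤ s → s ≤ r → r ≤ t → E.W s r ∘L E.W r t = E.W s t
  W_continuous : ∀ ψ : H,
    ContinuousOn (fun p : ℝ × ℝ => E.W p.1 p.2 ψ) {p | 0 ≤ p.1 ∧ p.1 ≤ p.2}
  /-- `W_{s,t}` maps `D` into `D`. -/
  W_mapsTo : ∀ s t, 0 ≤ s → s ≤ t → ∀ ψ ∈ E.D, E.W s t ψ ∈ E.D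
  /-- `∂W_{s,t}/∂t = - W_{s,t} G_t` and `∂W_{s,t}/∂s = G_s W_{s,t}` on `D`. -/
  W_deriv_right : ∀ s t, 0 ≤ s → s ≤ t → ∀ ψ ∈ E.D,
    HasDerivWithinAt (fun r => E.W s r ψ) (-(E.W s t (pApply (E.G t) ψ))) (Ici s) t
  W_deriv_left : ∀ s t, 0 ≤ s → s ≤ t → ∀ ψ ∈ E.D,
    HasDerivWithinAt (fun r => E.W r t ψ) (pApply (E.G s) (E.W s t ψ)) (Icc 0 t) s
  /-- `D` is contained in the domain of `Λ ^ (1 / 2)`, hence in that of the forms `Φ_t(X)`. -/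
  D_le_rootΛ : E.D ≤ E.rootΛ.domain
  /-- `G_t^* + G_t = Φ_t(I)` on `D`, as forms; equivalently, `G_t = Φ_t(I) / 2 + i H_t` with a
  symmetric `H_t`. -/
  G_add_adjoint : ∀ t, 0 ≤ t → ∀ φ ∈ E.D, ∀ ψ ∈ E.D,
    inner ℂ (pApply (E.G t) φ) ψ + inner ℂ φ (pApply (E.G t) ψ) = E.Φ t 1 φ ψ
  /-- `Φ_t(I)` is an operator: its form on `D` is closable, that is, it is the restriction to `D`
  of the form of a positive self-adjoint operator. -/
  Φ_closable : ∀ t, 0 ≤ t → FormClosable E.D fun ψ => (E.Φ t 1 ψ ψ).re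
  /-- For `ψ ∈ D`, the vectors `Λ ^ (1 / 2) W_{s,t} ψ` are locally square integrable in `s` and norm
  continuous in `t`. -/
  rootΛ_W_memLp : ∀ t, 0 ≤ t → ∀ ψ ∈ E.D,
    MemLp (fun s => pApply E.rootΛ (E.W s t ψ)) 2 (volume.restrict (Icc 0 t))
  rootΛ_W_continuous : ∀ s, 0 ≤ s → ∀ ψ ∈ E.D,
    ContinuousOn (fun t => pApply E.rootΛ (E.W s t ψ)) (Ici s)
  /-- There is a Kraus decomposition `A_t(X) = ∑ₖ A_k(t)^* X A_k(t)` such that, with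
  `Φ_k(t) = A_k(t) Λ ^ (1 / 2)`, the set `D` is contained in the domain of `Λ ^ (1 / 2) Φ_k(t)`, and
  for `ψ ∈ D` the vectors `Λ ^ (1 / 2) Φ_k(s) W_{s,t} ψ` are locally square integrable in `s` and
  norm continuous in `t`. -/
  kraus : ∃ K : ℕ → ℝ → (H →L[ℂ] H),
    (∀ t, 0 ≤ t → ∀ (X : H →L[ℂ] H) (φ ψ : H),
      HasSum (fun k => inner ℂ (K k t φ) (X (K k t ψ))) (inner ℂ φ (E.A t X ψ))) ∧
    (∀ k t, 0 ≤ t → ∀ ψ ∈ E.D, K k t (pApply E.rootΛ ψ) ∈ E.rootΛ.domain) ∧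
    (∀ k t, 0 ≤ t → ∀ ψ ∈ E.D,
      MemLp (fun s => pApply E.rootΛ (K k s (pApply E.rootΛ (E.W s t ψ)))) 2
        (volume.restrict (Icc 0 t))) ∧
    (∀ k s, 0 ≤ s → ∀ ψ ∈ E.D,
      ContinuousOn (fun t => pApply E.rootΛ (K k s (pApply E.rootΛ (E.W s t ψ)))) (Ici s))

/-! ### The minimal solutions -/

/-- The iterates for the generator `lam Φ_t(B) - G_t^* B - B G_t`:
`P^{(0)}_{τ,t}(B) = V_{τ,t}(B)` and
`P^{(n+1)}_{τ,t}(B) = V_{τ,t}(B) + lam ∫_τ^t V_{s,t} Φ_s P^{(n)}_{τ,s}(B) ds`,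
where the integral is the bounded operator of the quadratic form
`ψ ↦ ∫_τ^t Φ_s(P^{(n)}_{τ,s}(B))[W_{s,t} ψ] ds` on `D`. -/
def picard (lam : ℝ) : ℕ → ℝ → ℝ → (H →L[ℂ] H) → (H →L[ℂ] H)
  | 0, τ, t, B => E.V τ t B
  | n + 1, τ, t, B => E.V τ t B + (lam : ℂ) • formOp E.D fun ψ =>
      ∫ s in τ..t, E.Φ s (picard lam n τ s B) (E.W s t ψ) (E.W s t ψ)

/-- The minimal solution for the generator `lam Φ_t(B) - G_t^* B - B G_t` on positive bounded `B`:
the least upper bound of the increasing sequence of iterates. -/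
def Pmin (lam τ t : ℝ) (B : H →L[ℂ] H) : H →L[ℂ] H := by
  classical exact
    if h : ∃ T : H →L[ℂ] H, IsLUB (range fun n => E.picard lam n τ t B) T then h.choose else 0

/-- The positive form `ψ ↦ P^{(lam)}_{s,t}(Φ_s(I))[ψ] ∈ [0, ∞]`. As for every normal positive map,
the value at the unbounded positive operator `Φ_s(I)` is the supremum of the values at the bounded
positive operators `X ≤ Φ_s(I)`. -/
def PminΦ (lam s t : ℝ) (ψ : H) : ℝ≥0∞ :=
  ⨆ (X : H →L[ℂ] H) (_ : 0 ≤ X)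
    (_ : ∀ φ ∈ E.D, (inner ℂ φ (X φ)).re ≤ (E.Φ s 1 φ φ).re),
    ENNReal.ofReal (inner ℂ ψ (E.Pmin lam s t X ψ)).re

/-- The form of the operator `∫_0^1 dlam ∫_τ^t ds P^{(lam)}_{s,t} Φ_s(I)`, with values in
`[0, ∞]`. -/
def Chat (τ t : ℝ) (ψ : H) : ℝ≥0∞ :=
  ∫⁻ lam in Ioc (0 : ℝ) 1, ∫⁻ s in Icc τ t, E.PminΦ lam s t ψ

end Coefficients

end MasterEquation

end

/-! Write $J$ for the operation $Y\mapsto\int_s^tV_{u,t}\Phi_u(Y_{s,u})\,du$ (`jump`), $Q_k=J^kV(I)$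
for the part of the evolution with exactly $k$ jumps, and $R_n=J^n(I)$. Differentiating
$\|W_{u,t}\psi\|^2$ in $u$ and using $G^*+G=\Phi(I)$ gives $V(I)+J(I)=I$
(`lintegral_quad_clampA_one_add`, `VFamily_add_jump_one`). Iterating, $R_n=Q_n+R_{n+1}$, so $R_n$
decreases, and the $n$-th Picard iterate of $I$ equals $I-R_{n+1}$ (`picard_one_add_iterate_jump`).
Unitality thus amounts to $R_n\to0$, and a dense set of vectors is enough.

With a factor $\lambda$ per jump, the iterates of $B$ are $\sum_{k\le n}\lambda^kJ^kV(B)$. At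
$B=\Phi_s(I)$, integration over $s$ turns the $k$-th term into $\lambda^kR_{k+1}$, and
$\int_0^1\lambda^k\,d\lambda=1/(k+1)$. Hence $\widehat C\ge\sum_kR_{k+1}/(k+1)$
(`sum_quad_iterate_jump_le_Chat`). The harmonic series diverges, so the decreasing sequence
$R_n[\psi]$ must tend to $0$ wherever $\widehat C[\psi]<\infty$ (`tendsto_quad_iterate_jump`).

The analytic work lies in the unboundedness of $\Phi_s(I)$. It is replaced by bounded Yosida
approximants from below, chosen measurably in $s$ (`exists_approximants`); closability makes their
forms converge on the core. The limit is carried through $k$ jumps by dominated convergence and the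
Kraus series (`tendsto_lintegral_iterate_jump`). All operators are handled through their forms with
values in $[0,\infty]$, so that Tonelli's theorem applies. -/

noncomputable section

namespace MasterEquation

open scoped NNReal

/-! ### Positive operators and their quadratic forms. -/

section QuadraticForms

variable {H : Type*} [NormedAddCommGroup H] [InnerProductSpace ℂ H]

/-- The quadratic form `ψ ↦ ⟪ψ, T ψ⟫` of a positive operator, with values in `[0, ∞]`. -/
def quad (T : H →L[ℂ] H) (ψ : H) : ℝ≥0∞ := ENNReal.ofReal (inner ℂ ψ (T ψ)).re

theorem quad_ne_top (T : H →L[ℂ] H) (ψ : H) : quad T ψ ≠ ⊤ := ENNReal.ofReal_ne_top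

theorem re_inner_nonneg {T : H →L[ℂ] H} (hT : 0 ≤ T) (ψ : H) : 0 ≤ (inner ℂ ψ (T ψ)).re :=
  ((ContinuousLinearMap.nonneg_iff_isPositive T).1 hT).re_inner_nonneg_right ψ

theorem inner_eq_coe_re {T : H →L[ℂ] H} (hT : 0 ≤ T) (ψ : H) :
    inner ℂ ψ (T ψ) = ((inner ℂ ψ (T ψ)).re : ℂ) :=
  Complex.eq_re_of_ofReal_le
    (((ContinuousLinearMap.nonneg_iff_isPositive T).1 hT).inner_nonneg_right ψ)

theorem toReal_quad {T : H →L[ℂ] H} (hT : 0 ≤ T) (ψ : H) :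
    (quad T ψ).toReal = (inner ℂ ψ (T ψ)).re :=
  ENNReal.toReal_ofReal (re_inner_nonneg hT ψ)

theorem inner_eq_toReal_quad {T : H →L[ℂ] H} (hT : 0 ≤ T) (ψ : H) :
    inner ℂ ψ (T ψ) = ((quad T ψ).toReal : ℂ) := by
  rw [toReal_quad hT, ← inner_eq_coe_re hT]

@[simp] theorem quad_zero (ψ : H) : quad (0 : H →L[ℂ] H) ψ = 0 := by simp [quad]

@[simp] theorem quad_apply_zero (T : H →L[ℂ] H) : quad T 0 = 0 := by simp [quad]

theorem one_nonneg_op : (0 : H →L[ℂ] H) ≤ 1 :=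
  (ContinuousLinearMap.nonneg_iff_isPositive 1).2 ContinuousLinearMap.isPositive_one

theorem quad_one (ψ : H) : quad 1 ψ = ENNReal.ofReal (‖ψ‖ ^ 2) := by
  rw [quad, one_apply_eq_self, ← inner_self_eq_norm_sq (𝕜 := ℂ)]; rfl

theorem quad_add {S T : H →L[ℂ] H} (hS : 0 ≤ S) (hT : 0 ≤ T) (ψ : H) :
    quad (S + T) ψ = quad S ψ + quad T ψ := by
  rw [quad, quad, quad, ← ENNReal.ofReal_add (re_inner_nonneg hS ψ) (re_inner_nonneg hT ψ)]
  simp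

theorem quad_smul {c : ℝ} (hc : 0 ≤ c) (T : H →L[ℂ] H) (ψ : H) :
    quad ((c : ℂ) • T) ψ = ENNReal.ofReal c * quad T ψ := by
  rw [quad, quad, ← ENNReal.ofReal_mul hc]
  simp

theorem smul_nonneg_op {c : ℝ} (hc : 0 ≤ c) {T : H →L[ℂ] H} (hT : 0 ≤ T) : 0 ≤ (c : ℂ) • T := by
  rw [ContinuousLinearMap.nonneg_iff_isPositive] at hT ⊢
  exact hT.smul_of_nonneg (by exact_mod_cast hc)

theorem continuous_quad (T : H →L[ℂ] H) : Continuous (quad T) := by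
  exact ENNReal.continuous_ofReal.comp (by fun_prop)

/-- Parallelogram identity with the nonnegative term at $x-y$ dropped. -/
theorem quad_add_apply_le {T : H →L[ℂ] H} (hT : 0 ≤ T) (x y : H) :
    quad T (x + y) ≤ 2 * quad T x + 2 * quad T y := by
  have h : (inner ℂ (x + y) (T (x + y))).re + (inner ℂ (x - y) (T (x - y))).re =
      2 * (inner ℂ x (T x)).re + 2 * (inner ℂ y (T y)).re := by
    simp only [map_add, map_sub, inner_add_left, inner_add_right, inner_sub_left, inner_sub_right,
      Complex.add_re, Complex.sub_re]
    ring
  have h2 := re_inner_nonneg hT (x - y)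
  have hx := re_inner_nonneg hT x
  have hy := re_inner_nonneg hT y
  have e2 : (2 : ℝ≥0∞) = ENNReal.ofReal 2 := by simp
  rw [quad, quad, quad, e2, ← ENNReal.ofReal_mul zero_le_two, ← ENNReal.ofReal_mul zero_le_two,
    ← ENNReal.ofReal_add (by positivity) (by positivity)]
  exact ENNReal.ofReal_le_ofReal (by linarith)

theorem nonneg_of_inner_nonneg_on_dense {s : Set H} (hs : Dense s) {T : H →L[ℂ] H}
    (h : ∀ ψ ∈ s, 0 ≤ inner ℂ ψ (T ψ)) : 0 ≤ T := by
  have hcl : IsClosed {ψ : H | (0 : ℂ) ≤ inner ℂ ψ (T ψ)} :=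
    isClosed_le continuous_const (by fun_prop)
  have hall : ∀ ψ : H, (0 : ℂ) ≤ inner ℂ ψ (T ψ) := fun ψ =>
    hcl.closure_subset_iff.2 h (hs ψ)
  rw [ContinuousLinearMap.nonneg_iff_isPositive, ContinuousLinearMap.isPositive_iff_complex]
  intro x
  have hx : (0 : ℂ) ≤ inner ℂ (T x) x := by
    rw [← inner_conj_symm]; exact star_nonneg_iff.2 (hall x)
  exact ⟨(Complex.eq_re_of_ofReal_le hx).symm, (Complex.le_def.1 hx).1⟩

variable [CompleteSpace H]

theorem le_of_quad_le_on_dense {s : Set H} (hs : Dense s) {S T : H →L[ℂ] H} (hS : 0 ≤ S)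
    (hT : 0 ≤ T) (h : ∀ ψ ∈ s, quad S ψ ≤ quad T ψ) : S ≤ T := by
  rw [← sub_nonneg]
  refine nonneg_of_inner_nonneg_on_dense hs fun ψ hψ => ?_
  rw [_root_.sub_apply, inner_sub_right, inner_eq_coe_re hS, inner_eq_coe_re hT]
  have := (ENNReal.ofReal_le_ofReal_iff (re_inner_nonneg hT ψ)).1 (h ψ hψ)
  rw [← Complex.ofReal_sub]
  exact_mod_cast sub_nonneg.2 this

theorem quad_mono {S T : H →L[ℂ] H} (h : S ≤ T) (ψ : H) : quad S ψ ≤ quad T ψ := by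
  refine ENNReal.ofReal_le_ofReal ?_
  have := re_inner_nonneg (sub_nonneg.2 h) ψ
  rw [_root_.sub_apply, inner_sub_right, Complex.sub_re] at this
  linarith

theorem quad_sum {ι : Type*} (s : Finset ι) {T : ι → H →L[ℂ] H} (hT : ∀ i, 0 ≤ T i) (ψ : H) :
    quad (∑ i ∈ s, T i) ψ = ∑ i ∈ s, quad (T i) ψ := by
  classical
  induction s using Finset.induction_on with
  | empty => simp
  | insert a s ha ih =>
    rw [Finset.sum_insert ha, Finset.sum_insert ha,
      quad_add (hT a) (Finset.sum_nonneg fun i _ => hT i), ih]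

theorem eq_of_quad_eq_on_dense {s : Set H} (hs : Dense s) {S T : H →L[ℂ] H} (hS : 0 ≤ S)
    (hT : 0 ≤ T) (h : ∀ ψ ∈ s, quad S ψ = quad T ψ) : S = T :=
  le_antisymm (le_of_quad_le_on_dense hs hS hT fun ψ hψ => (h ψ hψ).le)
    (le_of_quad_le_on_dense hs hT hS fun ψ hψ => (h ψ hψ).ge)

/-- Factor $M=S^*S$ and apply Cauchy–Schwarz. The sum on the right, rather than a product of square
roots, is a majorant that can be integrated term by term. -/
theorem norm_inner_le_of_nonneg {M : H →L[ℂ] H} (hM : 0 ≤ M) (x y : H) :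
    ‖inner ℂ x (M y)‖ ≤ ((inner ℂ x (M x)).re + (inner ℂ y (M y)).re) / 2 := by
  obtain ⟨S, rfl⟩ := CStarAlgebra.nonneg_iff_eq_star_mul_self.1 hM
  have key : ∀ a b : H, inner ℂ a ((star S * S) b) = inner ℂ (S a) (S b) := fun a b => by
    rw [ContinuousLinearMap.star_eq_adjoint, mul_apply_eq_comp,
      ContinuousLinearMap.adjoint_inner_right]
  have nsq : ∀ a : H, (inner ℂ (S a) (S a)).re = ‖S a‖ ^ 2 := fun a =>
    inner_self_eq_norm_sq (𝕜 := ℂ) (S a)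
  rw [key, key, key, nsq, nsq]
  nlinarith [norm_inner_le_norm (𝕜 := ℂ) (S x) (S y), sq_nonneg (‖S x‖ - ‖S y‖)]

/-- A bounded sesquilinear form on a dense subspace is the form of a bounded operator. -/
theorem exists_op_of_sesqForm {D : Submodule ℂ H} (hD : Dense (D : Set H)) {C : ℝ}
    (b : D → D → ℂ) (hadd : ∀ x y z, b x (y + z) = b x y + b x z)
    (hsmul : ∀ (a : ℂ) x y, b x (a • y) = a * b x y)
    (hadd' : ∀ x y z, b (x + y) z = b x z + b y z)
    (hsmul' : ∀ (a : ℂ) x y, b (a • x) y = star a * b x y)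
    (hb : ∀ x y, ‖b x y‖ ≤ C * ‖x‖ * ‖y‖) :
    ∃ T : H →L[ℂ] H, ∀ x y : D, inner ℂ (x : H) (T y) = b x y := by
  have hC : ∀ y : D, 0 ≤ max C 0 * ‖y‖ := fun y => by positivity
  have hdr : DenseRange D.subtypeL := by
    simpa [DenseRange] using hD
  have hui : IsUniformInducing D.subtypeL := isUniformInducing_val _
  have h1 : ∀ y : D, ∃ v : H, ∀ x : D, inner ℂ (x : H) v = b x y := by
    intro y
    let f : D →L[ℂ] ℂ := LinearMap.mkContinuous
      { toFun := fun x => star (b x y)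
        map_add' := fun x z => by rw [hadd', star_add]
        map_smul' := fun a x => by rw [hsmul', star_mul', star_star]; rfl } (max C 0 * ‖y‖)
      (fun x => by
        simp only [LinearMap.coe_mk, AddHom.coe_mk, norm_star]
        calc _ ≤ C * ‖x‖ * ‖y‖ := hb x y
          _ ≤ max C 0 * ‖x‖ * ‖y‖ := by gcongr; exact le_max_left _ _
          _ = _ := by ring)
    refine ⟨(InnerProductSpace.toDual ℂ H).symm (f.extend D.subtypeL), fun x => ?_⟩
    rw [← inner_conj_symm, InnerProductSpace.toDual_symm_apply]
    have := ContinuousLinearMap.extend_eq f hdr hui x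
    rw [Submodule.subtypeL_apply] at this
    rw [this]
    exact star_star _
  choose v hv using h1
  have hext : ∀ u w : H, (∀ x : D, inner ℂ (x : H) u = inner ℂ (x : H) w) → u = w :=
    fun u w h => hD.eq_of_inner_right ℂ fun z hz => h ⟨z, hz⟩
  let T₀ : D →L[ℂ] H := LinearMap.mkContinuous
    { toFun := v
      map_add' := fun y z => hext _ _ fun x => by rw [inner_add_right, hv, hv, hv, hadd]
      map_smul' := fun a y => hext _ _ fun x => by
        rw [RingHom.id_apply, inner_smul_right, hv, hv, hsmul] } (max C 0)
    (fun y => by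
      simp only [LinearMap.coe_mk, AddHom.coe_mk]
      -- The bound holds for $x\in D$; by density it may be tested at $x=v(y)$, which gives
      -- $\|v(y)\|^2\le C\|v(y)\|\|y\|$.
      have hcl : IsClosed {x : H | ‖inner ℂ x (v y)‖ ≤ max C 0 * ‖x‖ * ‖y‖} :=
        isClosed_le (by fun_prop) (by fun_prop)
      have hall : ‖inner ℂ (v y) (v y)‖ ≤ max C 0 * ‖v y‖ * ‖y‖ := by
        refine hcl.closure_subset_iff.2 (fun x hx => ?_) (hD (v y))
        have h2 := hv y ⟨x, hx⟩
        simp only at h2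
        rw [mem_ofPred_eq, h2]
        refine (hb _ _).trans ?_
        gcongr
        · exact le_max_left _ _
        · exact le_rfl
      rw [inner_self_eq_norm_sq_to_K, norm_pow, RCLike.norm_ofReal, abs_norm] at hall
      by_contra! hlt
      have hpos : 0 < ‖v y‖ := (hC y).trans_lt hlt
      nlinarith)
  refine ⟨T₀.extend D.subtypeL, fun x y => ?_⟩
  have := ContinuousLinearMap.extend_eq T₀ hdr hui y
  rw [Submodule.subtypeL_apply] at this
  rw [this]
  exact hv y x

/-- Normalising both vectors turns an additive bound into the multiplicative one, by homogeneity. -/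
theorem exists_op_of_sesqForm_of_norm_le_sq {D : Submodule ℂ H} (hD : Dense (D : Set H)) {C : ℝ}
    (b : D → D → ℂ) (hadd : ∀ x y z, b x (y + z) = b x y + b x z)
    (hsmul : ∀ (a : ℂ) x y, b x (a • y) = a * b x y)
    (hadd' : ∀ x y z, b (x + y) z = b x z + b y z)
    (hsmul' : ∀ (a : ℂ) x y, b (a • x) y = star a * b x y)
    (hb : ∀ x y, ‖b x y‖ ≤ C * (‖x‖ ^ 2 + ‖y‖ ^ 2)) :
    ∃ T : H →L[ℂ] H, ∀ x y : D, inner ℂ (x : H) (T y) = b x y := by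
  refine exists_op_of_sesqForm (C := 2 * C) hD b hadd hsmul hadd' hsmul' fun x y => ?_
  rcases eq_or_ne x 0 with rfl | hx
  · have := hsmul' 0 0 y
    rw [zero_smul] at this
    simp only [star_zero, zero_mul] at this
    simp [this]
  rcases eq_or_ne y 0 with rfl | hy
  · have := hsmul 0 x 0
    rw [zero_smul] at this
    simp only [zero_mul] at this
    simp [this]
  have hx' : 0 < ‖x‖ := norm_pos_iff.2 hx
  have hy' : 0 < ‖y‖ := norm_pos_iff.2 hy
  have h := hb (((‖x‖⁻¹ : ℝ) : ℂ) • x) (((‖y‖⁻¹ : ℝ) : ℂ) • y)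
  have n1 : ∀ z : D, 0 < ‖z‖ → ‖((‖z‖⁻¹ : ℝ) : ℂ) • z‖ = 1 := fun z hz => by
    rw [norm_smul, Complex.norm_real, norm_inv, norm_norm, inv_mul_cancel₀ hz.ne']
  rw [n1 x hx', n1 y hy', hsmul, hsmul', norm_mul, norm_mul, norm_star, Complex.norm_real,
    Complex.norm_real, norm_inv, norm_inv, norm_norm, norm_norm] at h
  have e : ‖b x y‖ = ‖x‖ * ‖y‖ * (‖y‖⁻¹ * (‖x‖⁻¹ * ‖b x y‖)) := by
    field_simp
  rw [e]
  calc ‖x‖ * ‖y‖ * (‖y‖⁻¹ * (‖x‖⁻¹ * ‖b x y‖)) ≤ ‖x‖ * ‖y‖ * (C * (1 ^ 2 + 1 ^ 2)) := by gcongr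
    _ = _ := by ring

/-- The weak integral `∫ L_a^* M_a L_a` of positive operators, as a bounded operator. -/
theorem exists_integral_op {α : Type*} [MeasurableSpace α] {μ : Measure α} {D : Submodule ℂ H}
    (hD : Dense (D : Set H)) (L : α → D →ₗ[ℂ] H) {M : α → H →L[ℂ] H} (hM : ∀ a, 0 ≤ M a)
    (hmeas : ∀ φ ψ : D, AEStronglyMeasurable (fun a => inner ℂ (L a φ) (M a (L a ψ))) μ)
    {c : ℝ≥0} (hbd : ∀ ψ : D, ∫⁻ a, quad (M a) (L a ψ) ∂μ ≤ c * quad 1 (ψ : H)) :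
    ∃ T : H →L[ℂ] H, 0 ≤ T ∧ (∀ ψ : H, quad T ψ ≤ c * quad 1 ψ) ∧
      (∀ ψ : D, inner ℂ (ψ : H) (T ψ) = ∫ a, inner ℂ (L a ψ) (M a (L a ψ)) ∂μ) ∧
      ∀ ψ : D, quad T ψ = ∫⁻ a, quad (M a) (L a ψ) ∂μ := by
  have hreint : ∀ ψ : D, Integrable (fun a => (inner ℂ (L a ψ) (M a (L a ψ))).re) μ := by
    intro ψ
    refine ⟨Complex.continuous_re.comp_aestronglyMeasurable (hmeas ψ ψ), ?_⟩
    rw [hasFiniteIntegral_iff_ofReal (ae_of_all _ fun a => re_inner_nonneg (hM a) _)]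
    exact (hbd ψ).trans_lt (ENNReal.mul_lt_top ENNReal.coe_lt_top (quad_ne_top _ _).lt_top)
  have hint : ∀ φ ψ : D, Integrable (fun a => inner ℂ (L a φ) (M a (L a ψ))) μ := fun φ ψ =>
    (((hreint φ).add (hreint ψ)).div_const 2).mono' (hmeas φ ψ)
      (ae_of_all _ fun a => norm_inner_le_of_nonneg (hM a) _ _)
  have hrebd : ∀ ψ : D, ∫ a, (inner ℂ (L a ψ) (M a (L a ψ))).re ∂μ ≤ c * ‖ψ‖ ^ 2 := by
    intro ψ
    rw [integral_eq_lintegral_of_nonneg_ae (ae_of_all _ fun a => re_inner_nonneg (hM a) _)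
      (hreint ψ).1]
    refine ENNReal.toReal_le_of_le_ofReal (by positivity) ((hbd ψ).trans_eq ?_)
    rw [quad_one, ENNReal.ofReal_mul c.coe_nonneg, ENNReal.ofReal_coe_nnreal, Submodule.norm_coe]
  obtain ⟨T, hT⟩ := exists_op_of_sesqForm_of_norm_le_sq (C := c / 2) hD
    (fun φ ψ => ∫ a, inner ℂ (L a φ) (M a (L a ψ)) ∂μ)
    (fun x y z => by
      simp only [map_add, inner_add_right]
      exact integral_add (hint x y) (hint x z))
    (fun a x y => by
      simp only [map_smul, inner_smul_right]
      exact integral_const_mul _ _)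
    (fun x y z => by
      simp only [map_add, inner_add_left]
      exact integral_add (hint x z) (hint y z))
    (fun a x y => by
      simp only [map_smul, inner_smul_left]
      exact integral_const_mul _ _)
    (fun x y => by
      calc _ ≤ ∫ a, ((inner ℂ (L a x) (M a (L a x))).re + (inner ℂ (L a y) (M a (L a y))).re) / 2
              ∂μ := norm_integral_le_of_norm_le (((hreint x).add (hreint y)).div_const 2)
            (ae_of_all _ fun a => norm_inner_le_of_nonneg (hM a) _ _)
        _ = (∫ a, (inner ℂ (L a x) (M a (L a x))).re ∂μ +
              ∫ a, (inner ℂ (L a y) (M a (L a y))).re ∂μ) / 2 := by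
            rw [integral_div, integral_add (hreint x) (hreint y)]
        _ ≤ _ := by linarith [hrebd x, hrebd y])
  have hreal : ∀ ψ : D, inner ℂ (ψ : H) (T ψ) =
      ((∫ a, (inner ℂ (L a ψ) (M a (L a ψ))).re ∂μ : ℝ) : ℂ) := fun ψ => by
    rw [hT, ← integral_complex_ofReal]
    exact integral_congr_ae (ae_of_all _ fun a => inner_eq_coe_re (hM a) _)
  have hT0 : 0 ≤ T := nonneg_of_inner_nonneg_on_dense hD fun ψ hψ => by
    rw [hreal ⟨ψ, hψ⟩]
    exact_mod_cast integral_nonneg fun a => re_inner_nonneg (hM a) _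
  have hq : ∀ ψ : D, quad T ψ = ∫⁻ a, quad (M a) (L a ψ) ∂μ := fun ψ => by
    rw [quad, hreal, Complex.ofReal_re, ofReal_integral_eq_lintegral_ofReal (hreint ψ)
      (ae_of_all _ fun a => re_inner_nonneg (hM a) _)]
    rfl
  refine ⟨T, hT0, fun ψ => ?_, fun ψ => hT ψ ψ, hq⟩
  have hle : T ≤ ((c : ℝ) : ℂ) • (1 : H →L[ℂ] H) := by
    refine le_of_quad_le_on_dense hD hT0 (smul_nonneg_op c.coe_nonneg zero_le_one) fun ψ hψ => ?_
    rw [quad_smul c.coe_nonneg, ENNReal.ofReal_coe_nnreal]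
    exact (hq ⟨ψ, hψ⟩).trans_le (hbd ⟨ψ, hψ⟩)
  have := quad_mono hle ψ
  rwa [quad_smul c.coe_nonneg, ENNReal.ofReal_coe_nnreal] at this

/-- Domination by the single bounded operator `R` controls the error $\psi-x$ uniformly in `m`. -/
theorem tendsto_quad_zero_of_dense {s : Set H} (hs : Dense s) {U : ℕ → H →L[ℂ] H}
    {R : H →L[ℂ] H} (hU : ∀ m, 0 ≤ U m) (hUR : ∀ m, U m ≤ R)
    (h : ∀ ψ ∈ s, Tendsto (fun m => quad (U m) ψ) atTop (𝓝 0)) (ψ : H) :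
    Tendsto (fun m => quad (U m) ψ) atTop (𝓝 0) := by
  rw [ENNReal.tendsto_nhds_zero]
  intro ε hε
  have hε4 : 0 < ε / 4 := ENNReal.div_pos hε.ne' (by simp)
  have hc : Continuous fun x => quad R (ψ - x) := (continuous_quad R).comp (by fun_prop)
  obtain ⟨x, hx, hxs⟩ := hs.inter_open_nonempty {x | quad R (ψ - x) < ε / 4}
    (isOpen_lt hc continuous_const) ⟨ψ, by simpa using hε4⟩
  filter_upwards [(ENNReal.tendsto_nhds_zero.1 (h x hxs)) (ε / 4) hε4] with m hm
  calc quad (U m) ψ = quad (U m) (x + (ψ - x)) := by rw [add_sub_cancel]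
    _ ≤ 2 * quad (U m) x + 2 * quad (U m) (ψ - x) := quad_add_apply_le (hU m) _ _
    _ ≤ 2 * (ε / 4) + 2 * (ε / 4) := by
        gcongr
        exact (quad_mono (hUR m) _).trans (le_of_lt hx)
    _ = ε := by
        rw [← two_mul, ← mul_assoc]
        norm_num
        exact ENNReal.mul_div_cancel (by simp) (by simp)

theorem tendsto_quad_of_dense {s : Set H} (hs : Dense s) {T : ℕ → H →L[ℂ] H}
    {R : H →L[ℂ] H} (hT : ∀ m, 0 ≤ T m) (hTR : ∀ m, T m ≤ R)
    (h : ∀ ψ ∈ s, Tendsto (fun m => quad (T m) ψ) atTop (𝓝 (quad R ψ))) (ψ : H) :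
    Tendsto (fun m => quad (T m) ψ) atTop (𝓝 (quad R ψ)) := by
  have hR : 0 ≤ R := (hT 0).trans (hTR 0)
  have hsub : ∀ m, 0 ≤ R - T m := fun m => sub_nonneg.2 (hTR m)
  have hadd : ∀ m x, quad R x = quad (T m) x + quad (R - T m) x := fun m x => by
    rw [← quad_add (hT m) (hsub m), add_sub_cancel]
  have h0 : Tendsto (fun m => quad (R - T m) ψ) atTop (𝓝 0) := by
    refine tendsto_quad_zero_of_dense hs hsub (fun m => sub_le_self _ (hT m)) (fun x hx => ?_) ψ
    have := ENNReal.Tendsto.sub (tendsto_const_nhds (x := quad R x)) (h x hx)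
      (Or.inl (quad_ne_top R x))
    rw [tsub_self] at this
    refine this.congr fun m => ?_
    rw [hadd m x, ENNReal.add_sub_cancel_left (quad_ne_top _ _)]
  have := ENNReal.Tendsto.sub (tendsto_const_nhds (x := quad R ψ)) h0
    (Or.inl (quad_ne_top R ψ))
  rw [tsub_zero] at this
  refine this.congr fun m => ?_
  rw [hadd m ψ, ENNReal.add_sub_cancel_right (quad_ne_top _ _)]

/-- A bounded increasing sequence of positive operators has a least upper bound. -/
theorem exists_isLUB_of_monotone {P : ℕ → H →L[ℂ] H} (hP : ∀ n, 0 ≤ P n) (hmono : Monotone P)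
    {c : ℝ≥0} (hc : ∀ n ψ, quad (P n) ψ ≤ c * quad 1 ψ) :
    ∃ T : H →L[ℂ] H, IsLUB (range P) T := by
  have hre : ∀ n ψ, (inner ℂ ψ (P n ψ)).re ≤ c * ‖ψ‖ ^ 2 := fun n ψ => by
    have := hc n ψ
    rwa [quad_one, ← ENNReal.ofReal_coe_nnreal, ← ENNReal.ofReal_mul c.coe_nonneg, quad,
      ENNReal.ofReal_le_ofReal_iff (by positivity)] at this
  have hq : ∀ ψ, ∃ l : ℂ, Tendsto (fun n => inner ℂ ψ (P n ψ)) atTop (𝓝 l) := fun ψ => by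
    have hm : Monotone fun n => (inner ℂ ψ (P n ψ)).re := fun a b hab => by
      have := re_inner_nonneg (sub_nonneg.2 (hmono hab)) ψ
      rw [_root_.sub_apply, inner_sub_right, Complex.sub_re] at this
      simpa using this
    have := tendsto_atTop_ciSup hm ⟨c * ‖ψ‖ ^ 2, by rintro _ ⟨n, rfl⟩; exact hre n ψ⟩
    refine ⟨_, ((Complex.continuous_ofReal.tendsto _).comp this).congr fun n => ?_⟩
    exact (inner_eq_coe_re (hP n) ψ).symm
  -- Polarization transfers convergence from the diagonal to all pairs of vectors.
  have hb : ∀ x y : (⊤ : Submodule ℂ H), ∃ l : ℂ,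
      Tendsto (fun n => inner ℂ (x : H) (P n y)) atTop (𝓝 l) := fun x y => by
    obtain ⟨l1, h1⟩ := hq (x + y)
    obtain ⟨l2, h2⟩ := hq (x - y)
    obtain ⟨l3, h3⟩ := hq (x + Complex.I • y)
    obtain ⟨l4, h4⟩ := hq (x - Complex.I • y)
    refine ⟨_, ((((h1.sub h2).sub (h3.const_mul Complex.I)).add
      (h4.const_mul Complex.I)).div_const 4).congr fun n => ?_⟩
    simp only [map_add, map_sub, map_smul, inner_add_left, inner_add_right, inner_sub_left,
      inner_sub_right, inner_smul_left, inner_smul_right, Complex.conj_I]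
    linear_combination (-(1 / 2 : ℂ) * inner ℂ (x : H) (P n y) +
      (1 / 2 : ℂ) * inner ℂ (y : H) (P n x)) * Complex.I_sq
  choose b hb using hb
  obtain ⟨T, hT⟩ := exists_op_of_sesqForm_of_norm_le_sq (D := ⊤) (C := c / 2) (by simp) b
    (fun x y z => tendsto_nhds_unique (hb x (y + z)) <| by
      simpa [inner_add_right] using (hb x y).add (hb x z))
    (fun a x y => tendsto_nhds_unique (hb x (a • y)) <| by
      simpa [inner_smul_right] using (hb x y).const_mul a)
    (fun x y z => tendsto_nhds_unique (hb (x + y) z) <| by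
      simpa [inner_add_left] using (hb x z).add (hb y z))
    (fun a x y => tendsto_nhds_unique (hb (a • x) y) <| by
      simpa [inner_smul_left, mul_comm] using (hb x y).const_mul (star a))
    (fun x y => le_of_tendsto (hb x y).norm <| Eventually.of_forall fun n => by
      refine (norm_inner_le_of_nonneg (hP n) _ _).trans ?_
      have h1 := hre n x
      have h2 := hre n y
      rw [Submodule.norm_coe] at h1 h2
      linarith)
  have hlim : ∀ ψ, Tendsto (fun n => inner ℂ ψ (P n ψ)) atTop (𝓝 (inner ℂ ψ (T ψ))) := fun ψ => by
    have := hb ⟨ψ, trivial⟩ ⟨ψ, trivial⟩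
    rwa [← hT] at this
  refine ⟨T, ?_, ?_⟩
  · rintro _ ⟨n, rfl⟩
    rw [← sub_nonneg]
    refine nonneg_of_inner_nonneg_on_dense dense_univ fun ψ _ => ?_
    rw [_root_.sub_apply, inner_sub_right]
    refine ge_of_tendsto ((hlim ψ).sub_const _) (eventually_atTop.2 ⟨n, fun k hk => ?_⟩)
    rw [← inner_sub_right, ← _root_.sub_apply, inner_eq_coe_re (sub_nonneg.2 (hmono hk))]
    exact_mod_cast re_inner_nonneg (sub_nonneg.2 (hmono hk)) ψ
  · intro S hS
    rw [← sub_nonneg]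
    refine nonneg_of_inner_nonneg_on_dense dense_univ fun ψ _ => ?_
    rw [_root_.sub_apply, inner_sub_right]
    refine ge_of_tendsto ((hlim ψ).const_sub _) (Eventually.of_forall fun k => ?_)
    have hk := sub_nonneg.2 (hS ⟨k, rfl⟩)
    rw [← inner_sub_right, ← _root_.sub_apply, inner_eq_coe_re hk]
    exact_mod_cast re_inner_nonneg hk ψ

end QuadraticForms

/-! ### Weak measurability on a separable Hilbert space. -/

section WeakMeasurability

variable {H : Type*} [NormedAddCommGroup H] [InnerProductSpace ℂ H]
variable {α : Type*} [MeasurableSpace α]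

theorem inner_apply_polarization (T : H →L[ℂ] H) (x y : H) :
    inner ℂ x (T y) = (inner ℂ (x + y) (T (x + y)) - inner ℂ (x - y) (T (x - y)) -
      Complex.I * inner ℂ (x + Complex.I • y) (T (x + Complex.I • y)) +
      Complex.I * inner ℂ (x - Complex.I • y) (T (x - Complex.I • y))) / 4 := by
  simp only [map_add, map_sub, map_smul, inner_add_left, inner_add_right, inner_sub_left,
    inner_sub_right, inner_smul_left, inner_smul_right, Complex.conj_I]
  linear_combination ((1 / 2 : ℂ) * inner ℂ x (T y) - (1 / 2 : ℂ) * inner ℂ y (T x)) *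
    Complex.I_sq

theorem measurable_inner_of_measurable_quad {Y : α → H →L[ℂ] H} (hY : ∀ a, 0 ≤ Y a)
    (hm : ∀ ψ, Measurable fun a => quad (Y a) ψ) (x y : H) :
    Measurable fun a => inner ℂ x (Y a y) := by
  have h : ∀ ψ, Measurable fun a => inner ℂ ψ (Y a ψ) := fun ψ => by
    simp only [fun a => inner_eq_toReal_quad (hY a) ψ]
    exact Complex.measurable_ofReal.comp (hm ψ).ennreal_toReal
  simp only [fun a => inner_apply_polarization (Y a) x y]
  exact ((((h _).sub (h _)).sub ((h _).const_mul _)).add ((h _).const_mul _)).div_const _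

theorem measurable_quad_of_dense {D : Set H} (hD : Dense D) {Y : α → H →L[ℂ] H}
    (hm : ∀ ψ ∈ D, Measurable fun a => quad (Y a) ψ) (ψ : H) :
    Measurable fun a => quad (Y a) ψ := by
  obtain ⟨u, hu, hlim⟩ := mem_closure_iff_seq_limit.1 (hD ψ)
  refine measurable_of_tendsto_metrizable (f := fun n a => quad (Y a) (u n))
    (fun n => hm _ (hu n)) (tendsto_pi_nhds.2 fun a => ?_)
  exact ((continuous_quad (Y a)).tendsto ψ).comp hlim

variable [TopologicalSpace.SeparableSpace H]

/-- Carathéodory argument: the function is continuous in the vectors and measurable in `a`, hence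
jointly measurable on a second countable space. -/
theorem measurable_inner_apply {Y : α → H →L[ℂ] H}
    (hm : ∀ x y, Measurable fun a => inner ℂ x (Y a y)) {u v : α → H}
    (hu : StronglyMeasurable u) (hv : StronglyMeasurable v) :
    Measurable fun a => inner ℂ (u a) (Y a (v a)) := by
  borelize H
  have : SecondCountableTopology H := UniformSpace.secondCountable_of_separable H
  have h := measurable_uncurry_of_continuous_of_measurable
    (u := fun (p : H × H) (a : α) => inner ℂ p.1 (Y a p.2)) (fun a => by fun_prop)
    (fun p => hm p.1 p.2)
  exact h.comp ((hu.measurable.prodMk hv.measurable).prodMk measurable_id)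

theorem measurable_quad_apply {Y : α → H →L[ℂ] H} (hY : ∀ a, 0 ≤ Y a)
    (hm : ∀ ψ, Measurable fun a => quad (Y a) ψ) {u : α → H} (hu : StronglyMeasurable u) :
    Measurable fun a => quad (Y a) (u a) :=
  (Complex.measurable_re.comp (measurable_inner_apply
    (measurable_inner_of_measurable_quad hY hm) hu hu)).ennreal_ofReal

variable [CompleteSpace H]

theorem exists_finset_sum_inner_smul_tendsto (H : Type*) [NormedAddCommGroup H]
    [InnerProductSpace ℂ H] [CompleteSpace H] [TopologicalSpace.SeparableSpace H] :
    ∃ p : ℕ → Finset H, (∀ N x, ‖∑ e ∈ p N, inner ℂ e x • e‖ ≤ ‖x‖) ∧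
      ∀ x : H, Tendsto (fun N => ∑ e ∈ p N, inner ℂ e x • e) atTop (𝓝 x) := by
  obtain ⟨w, b, hb⟩ := exists_hilbertBasis ℂ H
  -- Distinct orthonormal vectors are at distance $\sqrt2\ge1$, so the basis is discrete and, by
  -- separability, countable.
  have hdisc : DiscreteTopology w := by
    refine DiscreteTopology.of_forall_le_dist (r := 1) one_pos fun i j hij => ?_
    have h := b.orthonormal
    have hi : inner ℂ (b i) (b j) = 0 := h.2 hij
    have h1 : ‖b i‖ = 1 := h.1 i
    have h2 : ‖b j‖ = 1 := h.1 j
    have h3 := norm_sub_sq (𝕜 := ℂ) (b i) (b j)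
    rw [hi, h1, h2] at h3
    rw [hb] at h3
    show 1 ≤ dist i j
    rw [Subtype.dist_eq, dist_eq_norm]
    simp only [map_zero] at h3
    nlinarith [norm_nonneg ((i : H) - j)]
  have : SecondCountableTopology H := UniformSpace.secondCountable_of_separable H
  have hcount : Countable w := TopologicalSpace.separableSpace_iff_countable.1 inferInstance
  obtain ⟨F, hF⟩ := exists_seq_tendsto (atTop : Filter (Finset w))
  have hsum : ∀ N x, ∑ e ∈ (F N).map (Function.Embedding.subtype _), inner ℂ e x • e =
      ∑ i ∈ F N, inner ℂ (b i) x • b i := fun N x => by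
    rw [Finset.sum_map, hb]; rfl
  refine ⟨fun N => (F N).map (Function.Embedding.subtype _), fun N x => ?_, fun x => ?_⟩
  · simp only [hsum]
    set p := ∑ i ∈ F N, inner ℂ (b i) x • b i with hp
    have h1 : inner ℂ p p = inner ℂ p x := by
      conv_lhs => rw [hp]
      rw [b.orthonormal.inner_sum, hp, sum_inner]
      refine Finset.sum_congr rfl fun i _ => ?_
      rw [inner_smul_left]
    have h2 : ‖p‖ ^ 2 ≤ ‖p‖ * ‖x‖ := by
      rw [← inner_self_eq_norm_sq (𝕜 := ℂ), h1]
      exact (RCLike.re_le_norm _).trans (norm_inner_le_norm _ _)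
    by_contra! hlt
    have : 0 < ‖p‖ := (norm_nonneg x).trans_lt hlt
    nlinarith
  · simp only [hsum]
    have h := b.hasSum_repr x
    simp only [b.repr_apply_apply] at h
    exact Tendsto.comp (y := atTop) (g := fun s : Finset w => ∑ i ∈ s, inner ℂ (b i) x • b i)
      h hF

theorem stronglyMeasurable_of_measurable_inner {f : α → H}
    (hf : ∀ x, Measurable fun a => inner ℂ x (f a)) : StronglyMeasurable f := by
  obtain ⟨p, -, hp⟩ := exists_finset_sum_inner_smul_tendsto H
  refine stronglyMeasurable_of_tendsto atTop
    (f := fun N a => ∑ e ∈ p N, inner ℂ e (f a) • e) (fun N => ?_)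
    (tendsto_pi_nhds.2 fun a => hp (f a))
  exact Finset.stronglyMeasurable_fun_sum _ fun e _ =>
    (hf e).stronglyMeasurable.smul_const e

end WeakMeasurability

/-! ### Kraus maps: normality and measurability. -/

section Kraus

variable {H : Type*} [NormedAddCommGroup H] [InnerProductSpace ℂ H]

/-- `Ψ(X) = ∑ₖ Kₖ^* X Kₖ`, as a weakly convergent series. -/
def IsKraus (Ψ : (H →L[ℂ] H) → (H →L[ℂ] H)) (K : ℕ → H →L[ℂ] H) : Prop :=
  ∀ (X : H →L[ℂ] H) (φ ψ : H),
    HasSum (fun k => inner ℂ (K k φ) (X (K k ψ))) (inner ℂ φ (Ψ X ψ))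

variable {Ψ : (H →L[ℂ] H) → (H →L[ℂ] H)} {K : ℕ → H →L[ℂ] H}

theorem IsKraus.hasSum_re (h : IsKraus Ψ K) (X : H →L[ℂ] H) (φ : H) :
    HasSum (fun k => (inner ℂ (K k φ) (X (K k φ))).re) (inner ℂ φ (Ψ X φ)).re :=
  Complex.hasSum_re (h X φ φ)

theorem IsKraus.quad_eq (h : IsKraus Ψ K) {X : H →L[ℂ] H} (hX : 0 ≤ X) (φ : H) :
    quad (Ψ X) φ = ∑' k, quad X (K k φ) := by
  have := h.hasSum_re X φ
  rw [quad, ← this.tsum_eq,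
    ENNReal.ofReal_tsum_of_nonneg (fun k => re_inner_nonneg hX _) this.summable]
  rfl

theorem IsKraus.quad_le (h : IsKraus Ψ K) {X : H →L[ℂ] H} (hX : 0 ≤ X) {c : ℝ≥0∞}
    (hc : ∀ ψ, quad X ψ ≤ c * quad 1 ψ) (φ : H) : quad (Ψ X) φ ≤ c * quad (Ψ 1) φ := by
  rw [h.quad_eq hX, h.quad_eq one_nonneg_op, ← ENNReal.tsum_mul_left]
  exact ENNReal.tsum_le_tsum fun k => hc _

/-- Dominated convergence for the Kraus series, with majorant $C\|K_k\varphi\|^2$, summable because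
the series converges at $X=1$. -/
theorem IsKraus.tendsto_inner (h : IsKraus Ψ K) {X : ℕ → H →L[ℂ] H} {Y : H →L[ℂ] H} {C : ℝ}
    (hb : ∀ N x, ‖inner ℂ x (X N x)‖ ≤ C * ‖x‖ ^ 2)
    (hX : ∀ x, Tendsto (fun N => inner ℂ x (X N x)) atTop (𝓝 (inner ℂ x (Y x)))) (φ : H) :
    Tendsto (fun N => inner ℂ φ (Ψ (X N) φ)) atTop (𝓝 (inner ℂ φ (Ψ Y φ))) := by
  have hs : Summable fun k => C * ‖K k φ‖ ^ 2 := by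
    refine Summable.mul_left C ((h.hasSum_re 1 φ).summable.congr fun k => ?_)
    exact inner_self_eq_norm_sq (𝕜 := ℂ) (K k φ)
  simp only [← (h _ φ φ).tsum_eq]
  exact tendsto_tsum_of_dominated_convergence hs (fun k => hX _)
    (Eventually.of_forall fun N k => hb N _)

theorem IsKraus.nonneg (h : IsKraus Ψ K) {X : H →L[ℂ] H} (hX : 0 ≤ X) : 0 ≤ Ψ X := by
  refine nonneg_of_inner_nonneg_on_dense dense_univ fun ψ _ => ?_
  exact (h X ψ ψ).nonneg fun k =>
    ((ContinuousLinearMap.nonneg_iff_isPositive X).1 hX).inner_nonneg_right _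

variable [CompleteSpace H] [TopologicalSpace.SeparableSpace H] {α : Type*} [MeasurableSpace α]

/-- Both the map and its argument depend on `a`. Compressing `Y a` to finite rank makes
$\Psi_a(Z_N)$ a finite sum of measurable scalars times $\Psi_a$ of fixed rank-one operators;
`IsKraus.tendsto_inner` removes the compression. -/
theorem measurable_quad_kraus {Ψ : α → (H →L[ℂ] H) →ₗ[ℂ] (H →L[ℂ] H)}
    (hK : ∀ a, ∃ K, IsKraus (Ψ a) K)
    (hΨ : ∀ X x y, Measurable fun a => inner ℂ x (Ψ a X y)) {Y : α → H →L[ℂ] H}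
    (hY : ∀ x y, Measurable fun a => inner ℂ x (Y a y)) (φ : H) :
    Measurable fun a => quad (Ψ a (Y a)) φ := by
  obtain ⟨p, hp, hlim⟩ := exists_finset_sum_inner_smul_tendsto H
  let Z : ℕ → α → H →L[ℂ] H := fun N a => ∑ e ∈ p N, ∑ f ∈ p N,
    inner ℂ e (Y a f) • InnerProductSpace.rankOne ℂ e f
  have hZ : ∀ N a x, inner ℂ x (Z N a x) =
      inner ℂ (∑ e ∈ p N, inner ℂ e x • e) (Y a (∑ e ∈ p N, inner ℂ e x • e)) := by
    intro N a x
    simp only [Z, sum_apply, inner_sum, sum_inner, map_sum, map_smul, inner_smul_left,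
      inner_smul_right, smul_apply, InnerProductSpace.rankOne_apply, inner_conj_symm]
    rw [Finset.sum_comm]
    refine Finset.sum_congr rfl fun e _ => ?_
    rw [Finset.mul_sum]
    refine Finset.sum_congr rfl fun f _ => ?_
    ring
  have hZm : ∀ N, Measurable fun a => inner ℂ φ (Ψ a (Z N a) φ) := by
    intro N
    simp only [Z, map_sum, map_smul, sum_apply, inner_sum, smul_apply, inner_smul_right]
    exact Finset.measurable_fun_sum _ fun e _ => Finset.measurable_fun_sum _ fun f _ =>
      (hY e f).mul (hΨ _ φ φ)
  have : Measurable fun a => inner ℂ φ (Ψ a (Y a) φ) := by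
    refine measurable_of_tendsto_metrizable hZm (tendsto_pi_nhds.2 fun a => ?_)
    obtain ⟨K, hK⟩ := hK a
    refine hK.tendsto_inner (C := ‖Y a‖) (fun N x => ?_) (fun x => ?_) φ
    · rw [hZ]
      calc _ ≤ ‖∑ e ∈ p N, inner ℂ e x • e‖ * ‖Y a (∑ e ∈ p N, inner ℂ e x • e)‖ :=
            norm_inner_le_norm _ _
        _ ≤ ‖x‖ * (‖Y a‖ * ‖x‖) := by
            gcongr
            · exact hp N x
            · exact (Y a).le_opNorm_of_le (hp N x)
        _ = _ := by ring
    · simp only [hZ]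
      exact (hlim x).inner (((Y a).continuous.tendsto x).comp (hlim x))
  exact (Complex.measurable_re.comp this).ennreal_ofReal

end Kraus

/-! ### Partially defined operators and cores. -/

section

variable {H : Type*} [NormedAddCommGroup H] [InnerProductSpace ℂ H]

theorem pApply_of_mem {T : H →ₗ.[ℂ] H} {x : H} (hx : x ∈ T.domain) : pApply T x = T ⟨x, hx⟩ :=
  dif_pos hx

theorem pApply_add {T : H →ₗ.[ℂ] H} {x y : H} (hx : x ∈ T.domain) (hy : y ∈ T.domain) :
    pApply T (x + y) = pApply T x + pApply T y := by
  rw [pApply_of_mem hx, pApply_of_mem hy, pApply_of_mem (T.domain.add_mem hx hy),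
    ← LinearPMap.map_add]
  rfl

theorem pApply_smul {T : H →ₗ.[ℂ] H} (c : ℂ) {x : H} (hx : x ∈ T.domain) :
    pApply T (c • x) = c • pApply T x := by
  rw [pApply_of_mem hx, pApply_of_mem (T.domain.smul_mem c hx), ← LinearPMap.map_smul]
  rfl

/-- Project the closure of the restricted graph onto the first coordinate. If the restriction were
not closable, its `closure` would be the restriction itself by convention, and the domain would lie
in `D` outright. -/
theorem dense_core {T : H →ₗ.[ℂ] H} {D : Submodule ℂ H} (hT : Dense (T.domain : Set H))
    (h : T.HasCore D) : Dense (D : Set H) := by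
  have hsub : (T.domain : Set H) ⊆ closure (D : Set H) := by
    intro x hx
    by_cases hc : (T.domRestrict D).IsClosable
    · have hg := hc.graph_closure_eq_closure_graph
      rw [h.closure_eq] at hg
      have hxg : ((x, T ⟨x, hx⟩) : H × H) ∈ closure ((T.domRestrict D).graph : Set (H × H)) := by
        rw [← Submodule.topologicalClosure_coe, hg]
        exact T.mem_graph ⟨x, hx⟩
      have := image_closure_subset_closure_image continuous_fst ⟨_, hxg, rfl⟩
      refine closure_mono ?_ this
      rintro _ ⟨p, hp, rfl⟩
      obtain ⟨y, hy, -⟩ := LinearPMap.mem_graph_iff _ |>.1 hp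
      rw [← hy]
      exact y.2.1
    · have := h.closure_eq
      rw [LinearPMap.closure_def' hc] at this
      rw [← this] at hx
      exact subset_closure hx.1
  exact dense_iff_closure_eq.2 (univ_subset_iff.1
    ((hT.closure_eq ▸ closure_minimal hsub isClosed_closure)))

end

/-! ### The evolution on the core: conservation and measurability. -/

namespace Coefficients

variable {H : Type*} [NormedAddCommGroup H] [InnerProductSpace ℂ H] [CompleteSpace H]
variable (E : Coefficients H)

/-- The bounded completely positive map `A_u`, frozen at negative times. -/
def clampA (u : ℝ) : (H →L[ℂ] H) →ₗ[ℂ] (H →L[ℂ] H) := (E.A (max u 0)).toLinearMap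

/-- The set of pairs of times `0 ≤ s ≤ t`. -/
def timeSet : Set (ℝ × ℝ) := {p | 0 ≤ p.1 ∧ p.1 ≤ p.2}

theorem isClosed_timeSet : IsClosed timeSet :=
  (isClosed_le continuous_const continuous_fst).inter (isClosed_le continuous_fst continuous_snd)

theorem clampA_of_nonneg {u : ℝ} (hu : 0 ≤ u) (X : H →L[ℂ] H) : E.clampA u X = E.A u X := by
  rw [clampA, max_eq_left hu]; rfl

namespace DomainContinuity

variable {E} (hE : E.DomainContinuity)
include hE

theorem dense_D : Dense (E.D : Set H) := dense_core (hE.G_dense 0 le_rfl) (hE.G_core 0 le_rfl)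

theorem W_mem {u t : ℝ} (h : 0 ≤ u ∧ u ≤ t) (ψ : E.D) : E.W u t ψ ∈ E.D :=
  hE.W_mapsTo u t h.1 h.2 ψ ψ.2

theorem exists_isKraus (u : ℝ) : ∃ K, IsKraus (E.clampA u) K := by
  obtain ⟨K, hK, -⟩ := hE.kraus
  exact ⟨fun k => K k (max u 0), hK _ (le_max_right _ _)⟩

theorem clampA_nonneg (u : ℝ) {X : H →L[ℂ] H} (hX : 0 ≤ X) : 0 ≤ E.clampA u X :=
  (hE.exists_isKraus u).choose_spec.nonneg hX

theorem quad_clampA_le (u : ℝ) {X : H →L[ℂ] H} (hX : 0 ≤ X) {c : ℝ≥0∞}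
    (hc : ∀ ψ, quad X ψ ≤ c * quad 1 ψ) (φ : H) :
    quad (E.clampA u X) φ ≤ c * quad (E.clampA u 1) φ :=
  (hE.exists_isKraus u).choose_spec.quad_le hX hc φ

theorem measurable_inner_clampA (X : H →L[ℂ] H) (x y : H) :
    Measurable fun u => inner ℂ x (E.clampA u X y) := by
  let f : (H →L[ℂ] H) → ℂ := fun X => inner ℂ x (X y)
  -- Sequences concentrated at index $0$ exhibit a single matrix element as one of the functionals
  -- that define the ultraweak topology.
  let ξ : H → ℕ → H := fun z k => if k = 0 then z else 0
  have hξ : ∀ z, Summable fun k => ‖ξ z k‖ ^ 2 := fun z =>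
    summable_of_ne_finset_zero (s := {0}) fun k hk => by
      have : k ≠ 0 := by simpa using hk
      simp [ξ, this]
  have hf : @Continuous (H →L[ℂ] H) ℂ (ultraweak H) inferInstance f := by
    have e : f = fun X : H →L[ℂ] H => ∑' k, inner ℂ (ξ x k) (X (ξ y k)) := by
      funext X
      rw [tsum_eq_single 0 fun k hk => by simp [ξ, hk]]
      simp [ξ, f]
    rw [e]
    exact continuous_iInf_dom (i := ξ x) <| continuous_iInf_dom (i := ξ y) <|
      continuous_iInf_dom (i := hξ x) <| continuous_iInf_dom (i := hξ y) continuous_induced_dom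
  have h1 : ContinuousOn (fun u => f (E.A u X)) (Ici 0) :=
    @Continuous.comp_continuousOn ℝ (H →L[ℂ] H) ℂ _ (ultraweak H) _ _ _ _ hf (hE.A_continuous X)
  have h2 : Continuous fun u : ℝ => f (E.A (max u 0) X) :=
    h1.comp_continuous (by fun_prop) fun u => mem_Ici.2 (le_max_right _ _)
  exact h2.measurable

open Classical in
/-- The vectors `Λ ^ (1 / 2) W_{u,t} ψ`, extended by `0` to all pairs of times. -/
def rootW (u t : ℝ) : E.D →ₗ[ℂ] H :=
  if h : 0 ≤ u ∧ u ≤ t then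
    { toFun := fun ψ => pApply E.rootΛ (E.W u t ψ)
      map_add' := fun x y => by
        rw [Submodule.coe_add, map_add, pApply_add (hE.D_le_rootΛ (hE.W_mem h x))
          (hE.D_le_rootΛ (hE.W_mem h y))]
      map_smul' := fun c x => by
        rw [Submodule.coe_smul, map_smul, pApply_smul c (hE.D_le_rootΛ (hE.W_mem h x))]; rfl }
  else 0

theorem rootW_of_mem {u t : ℝ} (h : 0 ≤ u ∧ u ≤ t) (ψ : E.D) :
    hE.rootW u t ψ = pApply E.rootΛ (E.W u t ψ) := by
  rw [rootW, dif_pos h]; rfl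

theorem rootW_of_not_mem {u t : ℝ} (h : ¬ (0 ≤ u ∧ u ≤ t)) (ψ : E.D) :
    hE.rootW u t ψ = 0 := by
  rw [rootW, dif_neg h]; rfl

theorem inner_pApply_rootΛ {x y : H} (hx : x ∈ E.rootΛ.domain) (hy : y ∈ E.rootΛ.domain) :
    inner ℂ x (pApply E.rootΛ y) = inner ℂ (pApply E.rootΛ x) y := by
  have hsa := hE.rootΛ_sqrt.pos.selfAdjoint
  have h := LinearPMap.adjoint_isFormalAdjoint hsa.dense_domain
  rw [LinearPMap.isSelfAdjoint_def.1 hsa] at h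
  rw [pApply_of_mem hx, pApply_of_mem hy]
  exact (h ⟨x, hx⟩ ⟨y, hy⟩).symm

omit hE in
theorem V_nonneg (s t : ℝ) {B : H →L[ℂ] H} (hB : 0 ≤ B) : 0 ≤ E.V s t B := by
  rw [ContinuousLinearMap.nonneg_iff_isPositive] at hB ⊢
  exact hB.adjoint_conj (E.W s t)

omit hE in
theorem quad_V (s t : ℝ) (B : H →L[ℂ] H) (ψ : H) : quad (E.V s t B) ψ = quad B (E.W s t ψ) := by
  rw [quad, quad, V, ContinuousLinearMap.comp_apply, ContinuousLinearMap.comp_apply,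
    ContinuousLinearMap.adjoint_inner_right]

theorem Φ_eq_inner {u t : ℝ} (h : 0 ≤ u ∧ u ≤ t) (X : H →L[ℂ] H) (ψ : E.D) :
    E.Φ u X (E.W u t ψ) (E.W u t ψ) =
      inner ℂ (hE.rootW u t ψ) (E.clampA u X (hE.rootW u t ψ)) := by
  rw [hE.rootW_of_mem h, E.clampA_of_nonneg h.1]; rfl

/-- Conservation: `V_{s,t}(I) + ∫_s^t V_{u,t} Φ_u(I) du = I` on `D`. -/
theorem lintegral_quad_clampA_one_add {s t : ℝ} (h : 0 ≤ s ∧ s ≤ t) (ψ : E.D) :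
    (∫⁻ u in Ioc s t, quad (E.clampA u 1) (hE.rootW u t ψ)) + quad (E.V s t 1) ψ =
      quad 1 (ψ : H) := by
  set g : ℝ → ℝ := fun u => (inner ℂ (E.W u t ψ) (E.W u t ψ)).re with hg
  set g' : ℝ → ℝ := fun u =>
    (inner ℂ (hE.rootW u t ψ) (E.clampA u 1 (hE.rootW u t ψ))).re with hg'
  have hg'0 : ∀ u, 0 ≤ g' u := fun u => re_inner_nonneg (hE.clampA_nonneg u one_nonneg_op) _
  have hcW : ContinuousOn (fun u => E.W u t ψ) (Icc s t) :=
    (hE.W_continuous ψ).comp (f := fun u : ℝ => (u, t)) (by fun_prop)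
      fun u hu => ⟨h.1.trans hu.1, hu.2⟩
  have hcont : ContinuousOn g (Icc s t) :=
    Complex.continuous_re.comp_continuousOn (hcW.inner hcW)
  have hderiv : ∀ u ∈ Ioo s t, HasDerivAt g (g' u) u := by
    intro u hu
    have hut : 0 ≤ u ∧ u ≤ t := ⟨h.1.trans hu.1.le, hu.2.le⟩
    have h1 := (hE.W_deriv_left u t hut.1 hut.2 ψ ψ.2).hasDerivAt
      (Icc_mem_nhds (h.1.trans_lt hu.1) hu.2)
    have h2 := h1.inner ℂ h1
    have h3 := hE.G_add_adjoint u hut.1 _ (hE.W_mem hut ψ) _ (hE.W_mem hut ψ)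
    rw [hE.Φ_eq_inner hut, add_comm] at h3
    rw [h3] at h2
    exact (Complex.reCLM.hasFDerivAt.comp_hasDerivAt u h2)
  -- A nonnegative derivative of a continuous function is automatically integrable, so the
  -- fundamental theorem of calculus applies without further bounds.
  have hint := intervalIntegral.integrableOn_deriv_of_nonneg hcont hderiv fun u _ => hg'0 u
  have hftc := intervalIntegral.integral_eq_sub_of_hasDeriv_right_of_le h.2 hcont
    (fun u hu => (hderiv u hu).hasDerivWithinAt)
    ((intervalIntegrable_iff_integrableOn_Ioc_of_le h.2).2 hint)
  rw [intervalIntegral.integral_of_le h.2] at hftc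
  have e1 : ∫⁻ u in Ioc s t, quad (E.clampA u 1) (hE.rootW u t ψ) = ENNReal.ofReal (g t - g s) := by
    rw [← hftc, ofReal_integral_eq_lintegral_ofReal hint (ae_of_all _ hg'0)]
    rfl
  have hgs : 0 ≤ g t - g s := by
    rw [← hftc]; exact integral_nonneg hg'0
  have e2 : quad (E.V s t 1) (ψ : H) = ENNReal.ofReal (g s) := by rw [quad_V]; rfl
  have e3 : quad 1 (ψ : H) = ENNReal.ofReal (g t) := by
    rw [hg]; simp only [hE.W_self t (h.1.trans h.2)]; rfl
  have hgs0 : 0 ≤ g s := inner_self_nonneg (𝕜 := ℂ)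
  rw [e1, e2, e3, ← ENNReal.ofReal_add hgs hgs0, sub_add_cancel]

variable [TopologicalSpace.SeparableSpace H]

theorem stronglyMeasurable_W (ψ : H) :
    StronglyMeasurable (timeSet.indicator fun p : ℝ × ℝ => E.W p.1 p.2 ψ) := by
  classical
  have : SecondCountableTopology H := UniformSpace.secondCountable_of_separable H
  borelize H
  have h := (hE.W_continuous ψ).measurable_piecewise (s := timeSet)
    (g := 0) continuousOn_const isClosed_timeSet.measurableSet
  rw [piecewise_eq_indicator] at h
  exact h.stronglyMeasurable

/-- Tested against a vector of its domain, $\Lambda^{1/2}$ moves to that vector and leaves the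
measurable $W\psi$; such vectors are dense. -/
theorem stronglyMeasurable_rootW (ψ : E.D) :
    StronglyMeasurable fun p : ℝ × ℝ => hE.rootW p.1 p.2 ψ := by
  refine stronglyMeasurable_of_measurable_inner fun x => ?_
  obtain ⟨z, hz, hlim⟩ := mem_closure_iff_seq_limit.1
    (hE.rootΛ_sqrt.pos.selfAdjoint.dense_domain x)
  refine measurable_of_tendsto_metrizable (f := fun n p => inner ℂ (z n) (hE.rootW p.1 p.2 ψ))
    (fun n => ?_) (tendsto_pi_nhds.2 fun p => hlim.inner tendsto_const_nhds)
  have e : (fun p : ℝ × ℝ => inner ℂ (z n) (hE.rootW p.1 p.2 ψ)) = fun p =>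
      inner ℂ (pApply E.rootΛ (z n)) (timeSet.indicator (fun p : ℝ × ℝ => E.W p.1 p.2 ψ) p) := by
    funext p
    by_cases hp : 0 ≤ p.1 ∧ p.1 ≤ p.2
    · rw [hE.rootW_of_mem hp, indicator_of_mem (show p ∈ timeSet from hp),
        hE.inner_pApply_rootΛ (hz n) (hE.D_le_rootΛ (hE.W_mem hp ψ))]
    · rw [hE.rootW_of_not_mem hp, indicator_of_notMem (show p ∉ timeSet from hp),
        inner_zero_right, inner_zero_right]
  rw [e]
  exact (stronglyMeasurable_const.inner (hE.stronglyMeasurable_W ψ)).measurable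

theorem measurable_quad_clampA {α : Type*} [MeasurableSpace α] {f : α → ℝ} (hf : Measurable f)
    {Y : α → H →L[ℂ] H} (hY : ∀ a, 0 ≤ Y a) (hm : ∀ ψ, Measurable fun a => quad (Y a) ψ) (φ : H) :
    Measurable fun a => quad (E.clampA (f a) (Y a)) φ :=
  measurable_quad_kraus (fun a => hE.exists_isKraus (f a))
    (fun X x y => (hE.measurable_inner_clampA X x y).comp hf)
    (measurable_inner_of_measurable_quad hY hm) φ

end DomainContinuity

end Coefficients

/-- Over $\mathbb C$ the form on a dense subspace determines the bounded operator, so the choice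
made in `formOp` is immaterial. -/
theorem formOp_eq {H : Type*} [NormedAddCommGroup H] [InnerProductSpace ℂ H]
    {D : Submodule ℂ H} (hD : Dense (D : Set H)) {q : H → ℂ} {T : H →L[ℂ] H}
    (hT : ∀ ψ ∈ D, inner ℂ ψ (T ψ) = q ψ) : formOp D q = T := by
  have hex : ∃ T : H →L[ℂ] H, ∀ ψ ∈ D, inner ℂ ψ (T ψ) = q ψ := ⟨T, hT⟩
  rw [formOp, dif_pos hex]
  have h := hex.choose_spec
  set S := hex.choose
  have hcl : IsClosed {ψ : H | inner ℂ ψ (S ψ) = inner ℂ ψ (T ψ)} :=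
    isClosed_eq (by fun_prop) (by fun_prop)
  have hall : ∀ ψ : H, inner ℂ ψ (S ψ) = inner ℂ ψ (T ψ) := fun ψ =>
    hcl.closure_subset_iff.2 (fun x hx => (h x hx).trans (hT x hx).symm) (hD ψ)
  have := (ext_inner_map (S : H →ₗ[ℂ] H) T).1 fun x => by
    rw [← inner_conj_symm, ← inner_conj_symm ((T : H →ₗ[ℂ] H) x)]
    exact congrArg _ (hall x)
  exact ContinuousLinearMap.coe_injective this

/-! ### The jump operation on bounded positive families. -/

namespace Coefficients

variable {H : Type*} [NormedAddCommGroup H] [InnerProductSpace ℂ H]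

/-- A weakly measurable family of positive operators, bounded by `c`, on the pairs `0 ≤ s ≤ t` of
times. -/
structure IsFamily (c : ℝ≥0) (Y : ℝ → ℝ → (H →L[ℂ] H)) : Prop where
  nonneg : ∀ s t, 0 ≤ Y s t
  quad_le : ∀ s t ψ, quad (Y s t) ψ ≤ c * quad 1 ψ
  eq_zero : ∀ s t, ¬ (0 ≤ s ∧ s ≤ t) → Y s t = 0
  measurable : ∀ ψ, Measurable fun p : ℝ × ℝ => quad (Y p.1 p.2) ψ

theorem IsFamily.smul {c : ℝ≥0} {Y : ℝ → ℝ → (H →L[ℂ] H)} (hY : IsFamily c Y) {a : ℝ}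
    (ha : 0 ≤ a) : IsFamily (a.toNNReal * c) ((a : ℂ) • Y) where
  nonneg s t := smul_nonneg_op ha (hY.nonneg s t)
  quad_le s t ψ := by
    rw [Pi.smul_apply, Pi.smul_apply, quad_smul ha, ENNReal.coe_mul, mul_assoc]
    exact mul_le_mul_right (hY.quad_le s t ψ) _
  eq_zero s t h := by
    rw [Pi.smul_apply, Pi.smul_apply, hY.eq_zero s t h, smul_zero]
  measurable ψ := by
    simp only [Pi.smul_apply, quad_smul ha]
    exact (hY.measurable ψ).const_mul _

theorem isFamily_zero : IsFamily 0 (0 : ℝ → ℝ → (H →L[ℂ] H)) where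
  nonneg s t := le_rfl
  quad_le s t ψ := by simp
  eq_zero s t h := rfl
  measurable ψ := by simp

theorem measurableSet_timeSet : MeasurableSet timeSet := isClosed_timeSet.measurableSet

open Classical in
/-- The identity operator at all pairs of times `0 ≤ s ≤ t`. -/
def oneFamily (s t : ℝ) : H →L[ℂ] H := if 0 ≤ s ∧ s ≤ t then 1 else 0

theorem isFamily_oneFamily : IsFamily 1 (oneFamily : ℝ → ℝ → (H →L[ℂ] H)) where
  nonneg s t := by
    rw [oneFamily]; split_ifs
    exacts [one_nonneg_op, le_rfl]
  quad_le s t ψ := by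
    rw [oneFamily]; split_ifs
    · simp
    · simp
  eq_zero s t h := if_neg h
  measurable ψ := by
    have e : (fun p : ℝ × ℝ => quad (oneFamily p.1 p.2) ψ) =
        timeSet.indicator fun _ => quad 1 ψ := by
      funext p
      by_cases hp : 0 ≤ p.1 ∧ p.1 ≤ p.2
      · rw [oneFamily, if_pos hp, indicator_of_mem (show p ∈ timeSet from hp)]
      · rw [oneFamily, if_neg hp, indicator_of_notMem (show p ∉ timeSet from hp), quad_zero]
    rw [e]
    exact measurable_const.indicator measurableSet_timeSet

variable [CompleteSpace H]

theorem IsFamily.add {c d : ℝ≥0} {Y Z : ℝ → ℝ → (H →L[ℂ] H)} (hY : IsFamily c Y)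
    (hZ : IsFamily d Z) : IsFamily (c + d) (Y + Z) where
  nonneg s t := add_nonneg (hY.nonneg s t) (hZ.nonneg s t)
  quad_le s t ψ := by
    rw [Pi.add_apply, Pi.add_apply, quad_add (hY.nonneg s t) (hZ.nonneg s t), ENNReal.coe_add,
      add_mul]
    exact add_le_add (hY.quad_le s t ψ) (hZ.quad_le s t ψ)
  eq_zero s t h := by
    rw [Pi.add_apply, Pi.add_apply, hY.eq_zero s t h, hZ.eq_zero s t h, add_zero]
  measurable ψ := by
    simp only [Pi.add_apply, quad_add (hY.nonneg _ _) (hZ.nonneg _ _)]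
    exact (hY.measurable ψ).add (hZ.measurable ψ)

theorem IsFamily.sum {ι : Type*} (F : Finset ι) {c : ι → ℝ≥0} {Y : ι → ℝ → ℝ → (H →L[ℂ] H)}
    (hY : ∀ i, IsFamily (c i) (Y i)) : IsFamily (∑ i ∈ F, c i) (∑ i ∈ F, Y i) := by
  classical
  induction F using Finset.induction_on with
  | empty => simpa using isFamily_zero
  | insert a s ha ih =>
    rw [Finset.sum_insert ha, Finset.sum_insert ha]
    exact (hY a).add ih

variable (E : Coefficients H)

open Classical in
/-- The family `V_{s,t}(X_s)`. -/
def VFamily (X : ℝ → H →L[ℂ] H) (s t : ℝ) : H →L[ℂ] H :=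
  if 0 ≤ s ∧ s ≤ t then E.V s t (X s) else 0

open Classical in
/-- The family `∫_s^t V_{u,t} Φ_u(Y_{s,u}) du`. -/
def jump (Y : ℝ → ℝ → (H →L[ℂ] H)) (s t : ℝ) : H →L[ℂ] H :=
  if 0 ≤ s ∧ s ≤ t then
    formOp E.D fun ψ => ∫ u in s..t, E.Φ u (Y s u) (E.W u t ψ) (E.W u t ψ)
  else 0

namespace DomainContinuity

variable {E} (hE : E.DomainContinuity)
include hE

theorem quad_one_W_le {s t : ℝ} (h : 0 ≤ s ∧ s ≤ t) (ψ : H) :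
    quad 1 (E.W s t ψ) ≤ quad 1 ψ := by
  rw [quad_one, quad_one]
  refine ENNReal.ofReal_le_ofReal ?_
  gcongr
  simpa using (E.W s t).le_of_opNorm_le (hE.W_contract s t h.1 h.2) ψ

/-- Positivity compares $Y_u$ with $c\,I$, for which conservation is exact. Keeping $c\,V(I)$ on the
left is what prevents the bound `c` from growing along the Picard iteration. -/
theorem lintegral_quad_clampA_le {Y : ℝ → H →L[ℂ] H} (hY : ∀ u, 0 ≤ Y u) {c : ℝ≥0}
    (hc : ∀ u ψ, quad (Y u) ψ ≤ c * quad 1 ψ) {s t : ℝ} (h : 0 ≤ s ∧ s ≤ t) (ψ : E.D) :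
    (∫⁻ u in Ioc s t, quad (E.clampA u (Y u)) (hE.rootW u t ψ)) + c * quad (E.V s t 1) ψ ≤
      c * quad 1 (ψ : H) := by
  rw [← hE.lintegral_quad_clampA_one_add h ψ, mul_add,
    ← lintegral_const_mul' _ _ ENNReal.coe_ne_top]
  exact add_le_add (lintegral_mono fun u => hE.quad_clampA_le u (hY u) (hc u) _) le_rfl

variable [TopologicalSpace.SeparableSpace H] {c : ℝ≥0} {Y Z : ℝ → ℝ → (H →L[ℂ] H)}

theorem measurable_inner_integrand (hY : IsFamily c Y) (s t : ℝ) (φ ψ : E.D) :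
    Measurable fun u =>
      inner ℂ (hE.rootW u t φ) (E.clampA u (Y s u) (hE.rootW u t ψ)) := by
  have hr : ∀ ψ : E.D, StronglyMeasurable fun u => hE.rootW u t ψ := fun ψ =>
    (hE.stronglyMeasurable_rootW ψ).comp_measurable (by fun_prop : Measurable fun u : ℝ => (u, t))
  refine measurable_inner_apply (measurable_inner_of_measurable_quad
    (fun u => hE.clampA_nonneg u (hY.nonneg s u)) fun x => ?_) (hr φ) (hr ψ)
  exact hE.measurable_quad_clampA measurable_id (fun u => hY.nonneg s u)
    (fun x => (hY.measurable x).comp (by fun_prop : Measurable fun u : ℝ => (s, u))) x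

theorem exists_jump (hY : IsFamily c Y) (s t : ℝ) :
    0 ≤ E.jump Y s t ∧ (∀ ψ, quad (E.jump Y s t) ψ ≤ c * quad 1 ψ) ∧
      ∀ ψ : E.D, quad (E.jump Y s t) ψ =
        ∫⁻ u in Ioc s t, quad (E.clampA u (Y s u)) (hE.rootW u t ψ) := by
  by_cases h : 0 ≤ s ∧ s ≤ t
  · obtain ⟨T, hT0, hTc, hT, hTq⟩ := exists_integral_op (μ := volume.restrict (Ioc s t)) (c := c)
      hE.dense_D (fun u => hE.rootW u t) (M := fun u => E.clampA u (Y s u))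
      (fun u => hE.clampA_nonneg u (hY.nonneg s u))
      (fun φ ψ => (hE.measurable_inner_integrand hY s t φ ψ).aestronglyMeasurable)
      (fun ψ => le_self_add.trans
        (hE.lintegral_quad_clampA_le (hY.nonneg s) (hY.quad_le s) h ψ))
    have e : E.jump Y s t = T := by
      rw [jump, if_pos h]
      refine formOp_eq hE.dense_D fun ψ hψ => ?_
      rw [hT ⟨ψ, hψ⟩, intervalIntegral.integral_of_le h.2]
      refine setIntegral_congr_fun measurableSet_Ioc fun u hu => ?_
      exact (hE.Φ_eq_inner ⟨h.1.trans hu.1.le, hu.2⟩ _ ⟨ψ, hψ⟩).symm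
    rw [e]
    exact ⟨hT0, hTc, hTq⟩
  · rw [jump, if_neg h]
    refine ⟨le_rfl, by simp, fun ψ => ?_⟩
    rw [quad_zero, eq_comm, lintegral_eq_zero_of_ae_eq_zero]
    refine ae_of_all _ fun u => ?_
    show quad (E.clampA u (Y s u)) (hE.rootW u t ψ) = 0
    by_cases hs : 0 ≤ s ∧ s ≤ u
    · rw [hE.rootW_of_not_mem fun hu => h ⟨hs.1, hs.2.trans hu.2⟩, quad_apply_zero]
    · rw [hY.eq_zero s u hs, map_zero, quad_zero]

theorem jump_nonneg (hY : IsFamily c Y) (s t : ℝ) : 0 ≤ E.jump Y s t :=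
  (hE.exists_jump hY s t).1

/-- The integrand vanishes outside $s\le u\le t$, so the limits can be dropped; Tonelli's theorem
then involves no moving endpoints. -/
theorem quad_jump (hY : IsFamily c Y) (s t : ℝ) (ψ : E.D) :
    quad (E.jump Y s t) ψ = ∫⁻ u, quad (E.clampA u (Y s u)) (hE.rootW u t ψ) := by
  rw [(hE.exists_jump hY s t).2.2, restrict_Ioc_eq_restrict_Icc, ← lintegral_indicator
    measurableSet_Icc]
  congr 1
  funext u
  by_cases hu : u ∈ Icc s t
  · rw [indicator_of_mem hu]
  · rw [indicator_of_notMem hu]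
    by_cases hs : 0 ≤ s ∧ s ≤ u
    · rw [hE.rootW_of_not_mem fun hu' => hu ⟨hs.2, hu'.2⟩, quad_apply_zero]
    · rw [hY.eq_zero s u hs, map_zero, quad_zero]

theorem measurable_integrand (hY : IsFamily c Y) (ψ : E.D) :
    Measurable fun q : (ℝ × ℝ) × ℝ => quad (E.clampA q.2 (Y q.1.1 q.2)) (hE.rootW q.2 q.1.2 ψ) := by
  refine measurable_quad_apply (fun q => hE.clampA_nonneg _ (hY.nonneg _ _)) (fun x => ?_)
    ((hE.stronglyMeasurable_rootW ψ).comp_measurable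
      (by fun_prop : Measurable fun q : (ℝ × ℝ) × ℝ => (q.2, q.1.2)))
  exact hE.measurable_quad_clampA measurable_snd (fun q => hY.nonneg _ _)
    (fun x => (hY.measurable x).comp
      (by fun_prop : Measurable fun q : (ℝ × ℝ) × ℝ => (q.1.1, q.2))) x

theorem isFamily_jump (hY : IsFamily c Y) : IsFamily c (E.jump Y) where
  nonneg := hE.jump_nonneg hY
  quad_le s t := (hE.exists_jump hY s t).2.1
  eq_zero s t h := if_neg h
  measurable := measurable_quad_of_dense hE.dense_D fun ψ hψ => by
    have e : (fun p : ℝ × ℝ => quad (E.jump Y p.1 p.2) ψ) = fun p =>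
        ∫⁻ u, quad (E.clampA u (Y p.1 u)) (hE.rootW u p.2 ⟨ψ, hψ⟩) :=
      funext fun p => hE.quad_jump hY p.1 p.2 ⟨ψ, hψ⟩
    rw [e]
    exact (hE.measurable_integrand hY ⟨ψ, hψ⟩).lintegral_prod_right'

theorem measurable_integrand_left (hY : IsFamily c Y) (s t : ℝ) (ψ : E.D) :
    Measurable fun u => quad (E.clampA u (Y s u)) (hE.rootW u t ψ) :=
  (hE.measurable_integrand hY ψ).comp (by fun_prop : Measurable fun u : ℝ => ((s, t), u))

theorem jump_add {d : ℝ≥0} (hY : IsFamily c Y) (hZ : IsFamily d Z) :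
    E.jump (Y + Z) = E.jump Y + E.jump Z := by
  funext s t
  refine eq_of_quad_eq_on_dense hE.dense_D (hE.jump_nonneg (hY.add hZ) s t)
    (add_nonneg (hE.jump_nonneg hY s t) (hE.jump_nonneg hZ s t)) fun ψ hψ => ?_
  rw [Pi.add_apply, Pi.add_apply, quad_add (hE.jump_nonneg hY s t) (hE.jump_nonneg hZ s t),
    hE.quad_jump (hY.add hZ) s t ⟨ψ, hψ⟩, hE.quad_jump hY s t ⟨ψ, hψ⟩,
    hE.quad_jump hZ s t ⟨ψ, hψ⟩, ← lintegral_add_left (hE.measurable_integrand_left hY s t _)]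
  refine lintegral_congr fun u => ?_
  rw [Pi.add_apply, Pi.add_apply, map_add, quad_add (hE.clampA_nonneg u (hY.nonneg s u))
    (hE.clampA_nonneg u (hZ.nonneg s u))]

theorem jump_smul (hY : IsFamily c Y) {a : ℝ} (ha : 0 ≤ a) :
    E.jump ((a : ℂ) • Y) = (a : ℂ) • E.jump Y := by
  funext s t
  refine eq_of_quad_eq_on_dense hE.dense_D (hE.jump_nonneg (hY.smul ha) s t)
    (smul_nonneg_op ha (hE.jump_nonneg hY s t)) fun ψ hψ => ?_
  rw [Pi.smul_apply, Pi.smul_apply, quad_smul ha, hE.quad_jump (hY.smul ha) s t ⟨ψ, hψ⟩,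
    hE.quad_jump hY s t ⟨ψ, hψ⟩, ← lintegral_const_mul' _ _ ENNReal.ofReal_ne_top]
  refine lintegral_congr fun u => ?_
  rw [Pi.smul_apply, Pi.smul_apply, map_smul, quad_smul ha]

theorem jump_zero : E.jump (0 : ℝ → ℝ → (H →L[ℂ] H)) = 0 := by
  have := hE.jump_smul isFamily_zero (le_refl (0 : ℝ))
  simpa using this

theorem jump_sum {ι : Type*} (F : Finset ι) {c : ι → ℝ≥0} {Y : ι → ℝ → ℝ → (H →L[ℂ] H)}
    (hY : ∀ i, IsFamily (c i) (Y i)) : E.jump (∑ i ∈ F, Y i) = ∑ i ∈ F, E.jump (Y i) := by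
  classical
  induction F using Finset.induction_on with
  | empty => simpa using hE.jump_zero
  | insert a s ha ih =>
    rw [Finset.sum_insert ha, Finset.sum_insert ha, hE.jump_add (hY a) (IsFamily.sum s hY), ih]

theorem isFamily_iterate_jump (hY : IsFamily c Y) (n : ℕ) : IsFamily c (E.jump^[n] Y) := by
  induction n with
  | zero => exact hY
  | succ n ih =>
    rw [Function.iterate_succ_apply']
    exact hE.isFamily_jump ih

theorem iterate_jump_add {d : ℝ≥0} (hY : IsFamily c Y) (hZ : IsFamily d Z) (n : ℕ) :
    E.jump^[n] (Y + Z) = E.jump^[n] Y + E.jump^[n] Z := by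
  induction n with
  | zero => rfl
  | succ n ih =>
    rw [Function.iterate_succ_apply', Function.iterate_succ_apply', Function.iterate_succ_apply',
      ih, hE.jump_add (hE.isFamily_iterate_jump hY n) (hE.isFamily_iterate_jump hZ n)]

theorem isFamily_VFamily {X : ℝ → H →L[ℂ] H} (hX : ∀ s, 0 ≤ X s)
    (hc : ∀ s ψ, quad (X s) ψ ≤ c * quad 1 ψ) (hm : ∀ ψ, Measurable fun s => quad (X s) ψ) :
    IsFamily c (E.VFamily X) where
  nonneg s t := by
    rw [VFamily]; split_ifs
    exacts [V_nonneg s t (hX s), le_rfl]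
  quad_le s t ψ := by
    rw [VFamily]; split_ifs with h
    · rw [quad_V]
      exact (hc s _).trans (mul_le_mul_right (hE.quad_one_W_le h ψ) _)
    · simp
  eq_zero s t h := if_neg h
  measurable ψ := by
    have e : (fun p : ℝ × ℝ => quad (E.VFamily X p.1 p.2) ψ) = fun p => quad (X p.1)
        (timeSet.indicator (fun p : ℝ × ℝ => E.W p.1 p.2 ψ) p) := by
      funext p
      by_cases hp : 0 ≤ p.1 ∧ p.1 ≤ p.2
      · rw [VFamily, if_pos hp, quad_V, indicator_of_mem (show p ∈ timeSet from hp)]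
      · rw [VFamily, if_neg hp, indicator_of_notMem (show p ∉ timeSet from hp), quad_zero,
          quad_apply_zero]
    rw [e]
    exact measurable_quad_apply (Y := fun p : ℝ × ℝ => X p.1) (fun p => hX p.1)
      (fun x => (hm x).comp measurable_fst)
      (hE.stronglyMeasurable_W ψ)

theorem isFamily_VFamily_const {B : H →L[ℂ] H} (hB : 0 ≤ B)
    (hc : ∀ ψ, quad B ψ ≤ c * quad 1 ψ) : IsFamily c (E.VFamily fun _ => B) :=
  hE.isFamily_VFamily (fun _ => hB) (fun _ => hc) fun _ => measurable_const

theorem isFamily_VFamily_one : IsFamily 1 (E.VFamily fun _ => 1) :=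
  hE.isFamily_VFamily_const one_nonneg_op fun ψ => by simp

theorem VFamily_add_jump_one :
    E.VFamily (fun _ => 1) + E.jump oneFamily = (oneFamily : ℝ → ℝ → (H →L[ℂ] H)) := by
  funext s t
  have h1 := hE.isFamily_VFamily_one
  have h2 := hE.isFamily_jump isFamily_oneFamily
  refine eq_of_quad_eq_on_dense hE.dense_D ((h1.add h2).nonneg s t)
    (isFamily_oneFamily.nonneg s t) fun ψ hψ => ?_
  by_cases h : 0 ≤ s ∧ s ≤ t
  · rw [Pi.add_apply, Pi.add_apply, quad_add (h1.nonneg s t) (h2.nonneg s t),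
      (hE.exists_jump isFamily_oneFamily s t).2.2 ⟨ψ, hψ⟩, VFamily, if_pos h, oneFamily, if_pos h,
      ← hE.lintegral_quad_clampA_one_add h ⟨ψ, hψ⟩, add_comm]
    congr 1
    refine setLIntegral_congr_fun measurableSet_Ioc fun u hu => ?_
    rw [oneFamily, if_pos ⟨h.1, hu.1.le⟩]
  · rw [(h1.add h2).eq_zero s t h, isFamily_oneFamily.eq_zero s t h]

/-- The iterated jump operators decompose the identity. -/
theorem iterate_jump_oneFamily (n : ℕ) :
    E.jump^[n] oneFamily =
      E.jump^[n] (E.VFamily fun _ => 1) + E.jump^[n + 1] (oneFamily : ℝ → ℝ → (H →L[ℂ] H)) := by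
  rw [Function.iterate_succ_apply, ← hE.iterate_jump_add hE.isFamily_VFamily_one
    (hE.isFamily_jump isFamily_oneFamily), hE.VFamily_add_jump_one]

theorem sum_iterate_jump_add (n : ℕ) :
    ∑ k ∈ Finset.range n, E.jump^[k] (E.VFamily fun _ => 1) + E.jump^[n] oneFamily =
      (oneFamily : ℝ → ℝ → (H →L[ℂ] H)) := by
  induction n with
  | zero => simp
  | succ n ih => rw [Finset.sum_range_succ, add_assoc, ← hE.iterate_jump_oneFamily, ih]

theorem isFamily_VFamily_add_smul_jump {B : H →L[ℂ] H} (hB : 0 ≤ B)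
    (hc : ∀ ψ, quad B ψ ≤ c * quad 1 ψ) (hY : IsFamily c Y) {a : ℝ} (ha : 0 ≤ a) (ha1 : a ≤ 1) :
    IsFamily c ((E.VFamily fun _ => B) + (a : ℂ) • E.jump Y) := by
  have h1 := hE.isFamily_VFamily_const hB hc
  have h2 := (hE.isFamily_jump hY).smul ha
  have h := h1.add h2
  refine ⟨h.nonneg, fun s t => ?_, h.eq_zero, h.measurable⟩
  by_cases hst : 0 ≤ s ∧ s ≤ t
  · suffices hle : ((E.VFamily fun _ => B) + (a : ℂ) • E.jump Y) s t ≤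
        ((c : ℝ) : ℂ) • (1 : H →L[ℂ] H) by
      intro ψ
      have := quad_mono hle ψ
      rwa [quad_smul c.coe_nonneg, ENNReal.ofReal_coe_nnreal] at this
    refine le_of_quad_le_on_dense hE.dense_D (h.nonneg s t)
      (smul_nonneg_op c.coe_nonneg one_nonneg_op) fun ψ hψ => ?_
    rw [quad_smul c.coe_nonneg, ENNReal.ofReal_coe_nnreal, Pi.add_apply, Pi.add_apply,
      quad_add (h1.nonneg s t) (h2.nonneg s t), Pi.smul_apply, Pi.smul_apply, quad_smul ha,
      (hE.exists_jump hY s t).2.2 ⟨ψ, hψ⟩, VFamily, if_pos hst, quad_V]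
    refine le_trans ?_ (hE.lintegral_quad_clampA_le (hY.nonneg s) (hY.quad_le s) hst ⟨ψ, hψ⟩)
    rw [add_comm, quad_V]
    refine add_le_add (mul_le_of_le_one_left' ?_) (hc _)
    simpa using ha1
  · intro ψ
    rw [h.eq_zero s t hst, quad_zero]
    exact zero_le

end DomainContinuity

end Coefficients

/-! ### Yosida approximants of closable forms. -/

section Approximants

variable {H : Type*} [NormedAddCommGroup H] [InnerProductSpace ℂ H]

/-- The Yosida approximants of a closable form converge to it. -/
theorem tendsto_yosida {D : Submodule ℂ H} (L : D →ₗ[ℂ] H) {q : H → ℝ}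
    (hq : ∀ χ : D, q χ = ‖L χ‖ ^ 2)
    (hcl : FormClosable D q) {T : ℕ → H →L[ℂ] H} (hT : ∀ m, 0 ≤ T m)
    (hTq : ∀ m φ, quad (T m) φ =
      ⨅ χ : D, ENNReal.ofReal (‖L χ‖ ^ 2 + (m + 1 : ℝ) * ‖φ - χ‖ ^ 2)) (φ : D) :
    Tendsto (fun m => quad (T m) φ) atTop (𝓝 (ENNReal.ofReal (q φ))) := by
  set J : ℕ → D → ℝ := fun m χ => ‖L χ‖ ^ 2 + (m + 1 : ℝ) * ‖(φ : H) - χ‖ ^ 2 with hJ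
  have hJ0 : ∀ m χ, 0 ≤ J m χ := fun m χ => by positivity
  set a : ℕ → ℝ := fun m => (inner ℂ (φ : H) (T m φ)).re with ha
  have haT : ∀ m, quad (T m) φ = ENNReal.ofReal (a m) := fun m => rfl
  have ha0 : ∀ m, 0 ≤ a m := fun m => re_inner_nonneg (hT m) _
  have haJ : ∀ m χ, a m ≤ J m χ := fun m χ => by
    have := hTq m φ ▸ iInf_le (fun χ : D => ENNReal.ofReal (J m χ)) χ
    exact (ENNReal.ofReal_le_ofReal_iff (hJ0 m χ)).1 this
  have hex : ∀ m, ∃ χ, J m χ < a m + 1 / (m + 1 : ℝ) := fun m => by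
    have hlt : quad (T m) φ < ENNReal.ofReal (a m + 1 / (m + 1 : ℝ)) := by
      rw [haT]
      exact (ENNReal.ofReal_lt_ofReal_iff_of_nonneg (ha0 m)).2
        (lt_add_of_pos_right _ Nat.one_div_pos_of_nat)
    rw [hTq m φ, iInf_lt_iff] at hlt
    obtain ⟨χ, hχ⟩ := hlt
    exact ⟨χ, (ENNReal.ofReal_lt_ofReal_iff_of_nonneg (hJ0 m χ)).1 hχ⟩
  -- `u m` nearly minimises $J_m$; the infimum `a m` need not be attained in `D`.
  choose u hu using hex
  have haq : ∀ m, a m ≤ q φ := fun m => (haJ m φ).trans_eq (by simp [hJ, hq])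
  have hJmono : ∀ {m n : ℕ}, m ≤ n → ∀ χ, J m χ ≤ J n χ := fun hmn χ => by
    have : (_ : ℝ) ≤ _ := Nat.cast_le.2 hmn
    simp only [hJ]; gcongr
  have hmono : Monotone a := fun m n hmn => le_of_forall_pos_le_add fun ε hε => by
    have hlt : quad (T n) φ < ENNReal.ofReal (a n + ε) := by
      rw [haT]
      exact (ENNReal.ofReal_lt_ofReal_iff_of_nonneg (ha0 n)).2 (lt_add_of_pos_right _ hε)
    rw [hTq n φ, iInf_lt_iff] at hlt
    obtain ⟨χ, hχ⟩ := hlt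
    exact (haJ m χ).trans ((hJmono hmn χ).trans
      ((ENNReal.ofReal_lt_ofReal_iff_of_nonneg (hJ0 n χ)).1 hχ).le)
  have hconv := tendsto_atTop_ciSup hmono ⟨q φ, by rintro _ ⟨m, rfl⟩; exact haq m⟩
  set l := ⨆ m, a m
  have hinv : Tendsto (fun m : ℕ => 1 / (m + 1 : ℝ)) atTop (𝓝 0) :=
    tendsto_one_div_add_atTop_nhds_zero_nat
  -- Parallelogram law for $J_m$ at `u m`, `u n`: their midpoint has value at least `a m`, and
  -- $J_m\le J_n$ at `u n`. As `a` converges, `L (u m)` is Cauchy.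
  have hpar : ∀ m n, m ≤ n → ‖L (u m - u n)‖ ^ 2 ≤
      2 * ((a n - a m) + 1 / (m + 1 : ℝ) + 1 / (n + 1 : ℝ)) := fun m n hmn => by
    have h1 := hu m
    have h2 := (hJmono hmn (u n)).trans_lt (hu n)
    have h3 := haJ m ((2⁻¹ : ℂ) • (u m + u n))
    have h4 := parallelogram_law_with_norm ℂ (L (u m)) (L (u n))
    have h5 := parallelogram_law_with_norm ℂ ((φ : H) - u m) ((φ : H) - u n)
    have e1 : ‖L ((2⁻¹ : ℂ) • (u m + u n))‖ ^ 2 = ‖L (u m) + L (u n)‖ ^ 2 / 4 := by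
      rw [map_smul, map_add, norm_smul, mul_pow, norm_inv, Complex.norm_ofNat]; ring
    have e2 : ‖(φ : H) - ((2⁻¹ : ℂ) • (u m + u n) : D)‖ ^ 2 =
        ‖((φ : H) - u m) + ((φ : H) - u n)‖ ^ 2 / 4 := by
      have : (φ : H) - ((2⁻¹ : ℂ) • (u m + u n) : D) =
          (2⁻¹ : ℂ) • (((φ : H) - u m) + ((φ : H) - u n)) := by
        simp only [Submodule.coe_smul, Submodule.coe_add]
        module
      rw [this, norm_smul, mul_pow, norm_inv, Complex.norm_ofNat]; ring
    have e3 : (m + 1 : ℝ) * (‖((φ : H) - u m) + ((φ : H) - u n)‖ ^ 2) ≤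
        (m + 1 : ℝ) * (2 * (‖(φ : H) - u m‖ ^ 2 + ‖(φ : H) - u n‖ ^ 2)) := by
      gcongr
      nlinarith [sq_nonneg ‖((φ : H) - u m) - ((φ : H) - u n)‖]
    simp only [hJ, e1, e2] at h1 h2 h3
    rw [map_sub]
    nlinarith
  have hpar' : ∀ p : ℕ × ℕ, ‖L (u p.1 - u p.2)‖ ^ 2 ≤
      2 * (|a p.2 - a p.1| + 1 / (p.1 + 1 : ℝ) + 1 / (p.2 + 1 : ℝ)) := fun p => by
    rcases le_total p.1 p.2 with h | h
    · refine (hpar _ _ h).trans ?_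
      gcongr
      exact le_abs_self _
    · rw [← neg_sub (u p.2), map_neg, norm_neg, abs_sub_comm]
      refine (hpar _ _ h).trans ?_
      have := le_abs_self (a p.1 - a p.2)
      linarith
  have hfst : Tendsto (Prod.fst : ℕ × ℕ → ℕ) atTop atTop := by
    rw [← prod_atTop_atTop_eq]; exact tendsto_fst
  have hsnd : Tendsto (Prod.snd : ℕ × ℕ → ℕ) atTop atTop := by
    rw [← prod_atTop_atTop_eq]; exact tendsto_snd
  have hw : Tendsto (fun m => (φ : H) - u m) atTop (𝓝 0) := by
    have hb : ∀ m : ℕ, ‖(φ : H) - u m‖ ^ 2 ≤ (q φ + 1) * (1 / (m + 1 : ℝ)) := fun m => by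
      have h1 := hu m
      have h2 : (1 : ℝ) / (m + 1) ≤ 1 := by
        rw [div_le_one (by positivity)]; linarith [Nat.cast_nonneg (α := ℝ) m]
      have h3 := haq m
      rw [mul_one_div, le_div_iff₀ (by positivity)]
      simp only [hJ] at h1
      nlinarith [sq_nonneg ‖L (u m)‖]
    have h0 : Tendsto (fun m => ‖(φ : H) - u m‖ ^ 2) atTop (𝓝 0) := by
      refine squeeze_zero (fun m => by positivity) hb ?_
      simpa using hinv.const_mul (q φ + 1)
    have h1 := (Real.continuous_sqrt.tendsto _).comp h0
    rw [Real.sqrt_zero] at h1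
    rw [tendsto_zero_iff_norm_tendsto_zero]
    exact h1.congr fun m => Real.sqrt_sq (norm_nonneg _)
  -- Here closability enters: $\varphi-u_m\to0$ and is Cauchy for the form, so its form values tend
  -- to $0$.
  have hqw := hcl (fun m => (φ : H) - u m) (fun m => D.sub_mem φ.2 (u m).2) hw (by
    refine squeeze_zero (g := fun p : ℕ × ℕ =>
      2 * (|a p.2 - a p.1| + 1 / (p.1 + 1 : ℝ) + 1 / (p.2 + 1 : ℝ))) (fun p => ?_) (fun p => ?_) ?_
    · have := hq ((φ - u p.1) - (φ - u p.2))
      simp only [Submodule.coe_sub] at this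
      rw [this]; positivity
    · have := hq ((φ - u p.1) - (φ - u p.2))
      simp only [Submodule.coe_sub] at this
      rw [this, sub_sub_sub_cancel_left, ← neg_sub (u p.1), map_neg, norm_neg]
      exact hpar' p
    · have h1 : Tendsto (fun p : ℕ × ℕ => |a p.2 - a p.1|) atTop (𝓝 0) := by
        have := ((hconv.comp hsnd).sub (hconv.comp hfst)).abs
        simpa using this
      simpa using ((h1.add (hinv.comp hfst)).add (hinv.comp hsnd)).const_mul 2)
  have hLw : Tendsto (fun m => L φ - L (u m)) atTop (𝓝 0) := by
    rw [tendsto_zero_iff_norm_tendsto_zero]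
    have h1 := (Real.continuous_sqrt.tendsto _).comp hqw
    rw [Real.sqrt_zero] at h1
    refine h1.congr fun m => ?_
    have := hq (φ - u m)
    simp only [Submodule.coe_sub] at this
    rw [Function.comp_apply, this, Real.sqrt_sq (norm_nonneg _), map_sub]
  have hLu : Tendsto (fun m => ‖L (u m)‖ ^ 2 - 1 / (m + 1 : ℝ)) atTop (𝓝 (q φ)) := by
    have h1 : Tendsto (fun m => L (u m)) atTop (𝓝 (L φ)) := by
      have := (tendsto_const_nhds (x := L φ)).sub hLw
      simpa using this
    have := (h1.norm.pow 2).sub hinv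
    rwa [← hq, sub_zero] at this
  have : Tendsto a atTop (𝓝 (q φ)) := by
    refine tendsto_of_tendsto_of_tendsto_of_le_of_le hLu tendsto_const_nhds (fun m => ?_) haq
    have h1 := hu m
    have h2 : (0 : ℝ) ≤ (m + 1 : ℝ) * ‖(φ : H) - u m‖ ^ 2 := by positivity
    simp only [hJ] at h1
    show ‖L (u m)‖ ^ 2 - 1 / (m + 1 : ℝ) ≤ a m
    linarith
  exact (ENNReal.continuous_ofReal.tendsto _).comp this

variable [CompleteSpace H]

/-- The Yosida approximant of the form `χ ↦ ‖L χ‖ ^ 2`: its form is the infimal convolution with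
`m ‖·‖ ^ 2`. -/
theorem exists_yosida {D : Submodule ℂ H} (L : D →ₗ[ℂ] H) {m : ℝ} (hm : 0 ≤ m) :
    ∃ T : H →L[ℂ] H, 0 ≤ T ∧ ∀ φ, quad T φ =
      ⨅ χ : D, ENNReal.ofReal (‖L χ‖ ^ 2 + m * ‖φ - χ‖ ^ 2) := by
  let e := WithLp.prodContinuousLinearEquiv 2 ℂ H H
  let c : ℂ := (Real.sqrt m : ℝ)
  have hc : ∀ x : H, ‖c • x‖ ^ 2 = m * ‖x‖ ^ 2 := fun x => by
    rw [norm_smul, mul_pow, Complex.norm_real, Real.norm_eq_abs, sq_abs, Real.sq_sqrt hm]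
  -- The infimum is the squared distance in $H\oplus H$ from $(\sqrt m\,\varphi,0)$ to the range of
  -- $\chi\mapsto(\sqrt m\,\chi,L\chi)$, so the operator is $\iota^*Q\iota$ with $Q$ the projection
  -- onto the orthogonal complement of that range.
  let f : D →ₗ[ℂ] WithLp 2 (H × H) := e.symm.toLinearEquiv.toLinearMap ∘ₗ
    ((c • D.subtype).prod L)
  let ι : H →L[ℂ] WithLp 2 (H × H) :=
    e.symm.toContinuousLinearMap ∘L ContinuousLinearMap.inl ℂ H H ∘L (c • (1 : H →L[ℂ] H))
  let S : Submodule ℂ (WithLp 2 (H × H)) := (LinearMap.range f).topologicalClosure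
  have : CompleteSpace S :=
    (LinearMap.range f).isClosed_topologicalClosure.completeSpace_coe
  have hdist : ∀ φ (χ : D), ‖ι φ - f χ‖ ^ 2 = ‖L χ‖ ^ 2 + m * ‖φ - χ‖ ^ 2 := fun φ χ => by
    rw [WithLp.prod_norm_sq_eq_of_L2, ← hc, smul_sub]
    have h1 : (ι φ - f χ).fst = c • φ - c • (χ : H) := rfl
    have h2 : (ι φ - f χ).snd = 0 - L χ := rfl
    rw [h1, h2, zero_sub, norm_neg, add_comm]
  let Q := Sᗮ.starProjection
  have hQ : Q.IsPositive := by
    exact ContinuousLinearMap.IsPositive.of_isStarProjection isStarProjection_starProjection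
  have hQeq : ∀ x, Q x = x - S.starProjection x := fun x => by
    have := Submodule.starProjection_add_starProjection_orthogonal (K := S) x
    rw [eq_sub_iff_add_eq, add_comm]; exact this
  have hquad : ∀ φ, (inner ℂ φ ((ContinuousLinearMap.adjoint ι ∘L Q ∘L ι) φ)).re =
      ‖Q (ι φ)‖ ^ 2 := fun φ => by
    rw [ContinuousLinearMap.comp_apply, ContinuousLinearMap.adjoint_inner_right,
      ← inner_self_eq_norm_sq (𝕜 := ℂ)]
    change (inner ℂ (ι φ) (Q (ι φ))).re = _
    have h1 : Q (Q (ι φ)) = Q (ι φ) :=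
      Submodule.starProjection_eq_self_iff.2 (Submodule.starProjection_apply_mem _ _)
    conv_lhs => rw [← h1]
    rw [← hQ.inner_left_eq_inner_right]; rfl
  refine ⟨ContinuousLinearMap.adjoint ι ∘L Q ∘L ι, ?_, fun φ => ?_⟩
  · rw [ContinuousLinearMap.nonneg_iff_isPositive]
    exact hQ.adjoint_conj ι
  rw [quad, hquad]
  refine le_antisymm (le_iInf fun χ => ?_) ?_
  · rw [← hdist]
    refine ENNReal.ofReal_le_ofReal ?_
    have hf : Q (f χ) = 0 := by
      rw [hQeq, sub_eq_zero, eq_comm]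
      exact Submodule.starProjection_eq_self_iff.2
        ((LinearMap.range f).le_topologicalClosure ⟨χ, rfl⟩)
    have : Q (ι φ) = Q (ι φ - f χ) := by rw [map_sub, hf, sub_zero]
    rw [this]
    gcongr
    exact Submodule.norm_starProjection_apply_le _ _
  · have hmem : S.starProjection (ι φ) ∈ closure (LinearMap.range f : Set (WithLp 2 (H × H))) :=
      Submodule.starProjection_apply_mem S _
    obtain ⟨v, hv, hlim⟩ := mem_closure_iff_seq_limit.1 hmem
    have h1 : Tendsto (fun n => ENNReal.ofReal (‖ι φ - v n‖ ^ 2)) atTop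
        (𝓝 (ENNReal.ofReal (‖Q (ι φ)‖ ^ 2))) := by
      rw [hQeq]
      exact (ENNReal.continuous_ofReal.tendsto _).comp
        (((tendsto_const_nhds (x := ι φ)).sub hlim).norm.pow 2)
    refine ge_of_tendsto h1 (Eventually.of_forall fun n => ?_)
    obtain ⟨χ, hχ⟩ := hv n
    rw [← hχ, hdist]
    exact iInf_le _ χ

end Approximants

namespace Coefficients.DomainContinuity

variable {H : Type*} [NormedAddCommGroup H] [InnerProductSpace ℂ H] [CompleteSpace H]
variable [TopologicalSpace.SeparableSpace H]
variable {E : Coefficients H} (hE : E.DomainContinuity)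
include hE

/-- Bounded positive approximants of `Φ_s(I)` from below, measurable in time. -/
theorem exists_approximants : ∃ X : ℕ → ℝ → H →L[ℂ] H, (∀ m s, 0 ≤ X m s) ∧
    (∀ m s φ, quad (X m s) φ ≤ ((m + 1 : ℝ≥0) : ℝ≥0∞) * quad 1 φ) ∧
    (∀ m φ, Measurable fun s => quad (X m s) φ) ∧
    (∀ m s, ∀ φ ∈ E.D, quad (X m s) φ ≤ quad (E.clampA s 1) (pApply E.rootΛ φ)) ∧
    ∀ s, ∀ φ ∈ E.D, Tendsto (fun m => quad (X m s) φ) atTop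
      (𝓝 (quad (E.clampA s 1) (pApply E.rootΛ φ))) := by
  let R : E.D →ₗ[ℂ] H :=
    { toFun := fun ψ => pApply E.rootΛ ψ
      map_add' := fun x y => pApply_add (hE.D_le_rootΛ x.2) (hE.D_le_rootΛ y.2)
      map_smul' := fun c x => pApply_smul c (hE.D_le_rootΛ x.2) }
  have hsqrt : ∀ s, ∃ M : H →L[ℂ] H, ∀ x, (inner ℂ x (E.clampA s 1 x)).re = ‖M x‖ ^ 2 := by
    intro s
    obtain ⟨M, hM⟩ := CStarAlgebra.nonneg_iff_eq_star_mul_self.1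
      (hE.clampA_nonneg s one_nonneg_op)
    refine ⟨M, fun x => ?_⟩
    rw [hM, ContinuousLinearMap.star_eq_adjoint, mul_apply_eq_comp,
      ContinuousLinearMap.adjoint_inner_right]
    exact inner_self_eq_norm_sq (𝕜 := ℂ) (M x)
  choose M hM using hsqrt
  let L : ℝ → E.D →ₗ[ℂ] H := fun s => (M s : H →ₗ[ℂ] H) ∘ₗ R
  have hL : ∀ s χ, ENNReal.ofReal (‖L s χ‖ ^ 2) = quad (E.clampA s 1) (pApply E.rootΛ χ) :=
    fun s χ => by rw [quad, hM]; rfl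
  have hX : ∀ (m : ℕ) s, ∃ T : H →L[ℂ] H, 0 ≤ T ∧ ∀ φ, quad T φ =
      ⨅ χ : E.D, ENNReal.ofReal (‖L s χ‖ ^ 2 + (m + 1 : ℝ) * ‖φ - χ‖ ^ 2) := fun m s =>
    exists_yosida (L s) (by positivity)
  choose X hX0 hXq using hX
  refine ⟨X, hX0, fun m s φ => ?_, fun m φ => ?_, fun m s φ hφ => ?_, fun s φ hφ => ?_⟩
  · rw [hXq]
    refine (iInf_le _ 0).trans_eq ?_
    rw [map_zero, norm_zero, quad_one, Submodule.coe_zero, sub_zero, zero_pow two_ne_zero, zero_add,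
      ENNReal.ofReal_mul (by positivity)]
    congr 1
    rw [← ENNReal.ofReal_coe_nnreal]
    simp
  -- To make the infimum countable, use a dense sequence in the graph of $\Lambda^{1/2}$ over `D`.
  -- The function minimised is continuous for the graph topology at every `s`, so one countable set
  -- serves all times.
  · let g : E.D → H × H := fun χ => (χ, pApply E.rootΛ χ)
    have : SecondCountableTopology H := UniformSpace.secondCountable_of_separable H
    obtain ⟨c, hcc, hcd⟩ := TopologicalSpace.exists_countable_dense (range g)
    let F : ℝ → H × H → ℝ≥0∞ := fun s p =>
      quad (E.clampA s 1) p.2 + ENNReal.ofReal ((m + 1 : ℝ) * ‖φ - p.1‖ ^ 2)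
    have hF : ∀ s, Continuous (F s) := fun s =>
      ((continuous_quad _).comp continuous_snd).add (ENNReal.continuous_ofReal.comp (by fun_prop))
    have e : (fun s => quad (X m s) φ) = fun s => ⨅ p ∈ c, F s p := by
      funext s
      have h1 : quad (X m s) φ = ⨅ p : range g, F s p := by
        rw [hXq, iInf_range' (fun p => F s p) g]
        refine iInf_congr fun χ => ?_
        rw [ENNReal.ofReal_add (by positivity) (by positivity), hL]
      rw [h1]
      refine le_antisymm (le_iInf₂ fun p _ => iInf_le _ p) (le_iInf fun p => ?_)
      have hcl : IsClosed {p : range g | ⨅ p ∈ c, F s p ≤ F s p} :=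
        isClosed_le continuous_const ((hF s).comp continuous_subtype_val)
      exact hcl.closure_subset_iff.2 (fun x hx =>
        iInf₂_le (f := fun (p : range g) (_ : p ∈ c) => F s p) x hx) (hcd p)
    rw [e]
    refine Measurable.biInf c hcc fun p _ => Measurable.add_const ?_ _
    exact (Complex.measurable_re.comp (hE.measurable_inner_clampA 1 _ _)).ennreal_ofReal
  · rw [hXq, ← hL s ⟨φ, hφ⟩]
    exact (iInf_le _ ⟨φ, hφ⟩).trans_eq (by simp)
  · have hcl := hE.Φ_closable (max s 0) (le_max_right _ _)
    have hq : ∀ χ : E.D, (E.Φ (max s 0) 1 χ χ).re = ‖L s χ‖ ^ 2 := fun χ => hM s _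
    have := tendsto_yosida (L s) hq hcl (fun m => hX0 m s) (fun m => hXq m s) ⟨φ, hφ⟩
    rw [hq, hL] at this
    exact this

end Coefficients.DomainContinuity

/-- These moments are the source of the harmonic weights. -/
theorem lintegral_Ioc_zero_one_pow (k : ℕ) :
    ∫⁻ lam in Ioc (0 : ℝ) 1, ENNReal.ofReal (lam ^ k) = ENNReal.ofReal (1 / (k + 1 : ℝ)) := by
  rw [← ofReal_integral_eq_lintegral_ofReal, ← intervalIntegral.integral_of_le zero_le_one,
    integral_pow]
  · simp
  · exact ((continuous_pow k).integrableOn_Icc (a := 0) (b := 1)).mono_set Ioc_subset_Icc_self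
  · exact (ae_restrict_iff' measurableSet_Ioc).2 (ae_of_all _ fun x hx => pow_nonneg hx.1.le k)

/-! ### Expansion of the Picard iterates by number of jumps. -/

namespace Coefficients

variable {H : Type*} [NormedAddCommGroup H] [InnerProductSpace ℂ H]

/-- The domain `Ici τ` does not depend on `t`, which is convenient when integrals are interchanged.
-/
theorem IsFamily.lintegral_Ici_eq {c : ℝ≥0} {Y : ℝ → ℝ → (H →L[ℂ] H)} (hY : IsFamily c Y) (τ t : ℝ)
    (ψ : H) : ∫⁻ s in Ici τ, quad (Y s t) ψ = ∫⁻ s in Icc τ t, quad (Y s t) ψ := by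
  rw [← lintegral_indicator measurableSet_Ici, ← lintegral_indicator measurableSet_Icc]
  congr 1
  funext s
  by_cases hs : s ≤ t
  · by_cases hτ : τ ≤ s
    · rw [indicator_of_mem (mem_Ici.2 hτ), indicator_of_mem (mem_Icc.2 ⟨hτ, hs⟩)]
    · rw [indicator_of_notMem fun h => hτ (mem_Ici.1 h),
        indicator_of_notMem fun h => hτ (mem_Icc.1 h).1]
  · rw [indicator_of_notMem fun h : s ∈ Icc τ t => hs (mem_Icc.1 h).2, indicator_apply_eq_zero]
    intro _
    rw [hY.eq_zero s t fun h => hs h.2, quad_zero]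

variable [CompleteSpace H]
variable {E : Coefficients H}

theorem jump_congr {Y Z : ℝ → ℝ → (H →L[ℂ] H)} {s : ℝ} (h : ∀ u, Y s u = Z s u) (t : ℝ) :
    E.jump Y s t = E.jump Z s t := by
  simp only [jump, h]

/-- The first time is a mere parameter of `jump`; a time-dependent `X s` may therefore be frozen at
the current `s`. -/
theorem iterate_jump_congr {Y Z : ℝ → ℝ → (H →L[ℂ] H)} {s : ℝ} (h : ∀ u, Y s u = Z s u) (n : ℕ)
    (t : ℝ) : E.jump^[n] Y s t = E.jump^[n] Z s t := by
  induction n generalizing t with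
  | zero => exact h t
  | succ n ih =>
    rw [Function.iterate_succ_apply', Function.iterate_succ_apply']
    exact jump_congr ih t

variable (E) in
/-- The partial sums `∑_{k ≤ n} lam ^ k Q_k(B)`, where `Q_k(B)` is the part with `k` jumps. -/
def jumpSum (lam : ℝ) (n : ℕ) (B : H →L[ℂ] H) : ℝ → ℝ → (H →L[ℂ] H) :=
  ∑ k ∈ Finset.range (n + 1), ((lam ^ k : ℝ) : ℂ) • E.jump^[k] (E.VFamily fun _ => B)

namespace DomainContinuity

variable [TopologicalSpace.SeparableSpace H] (hE : E.DomainContinuity)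
include hE

section Picard

variable {c : ℝ≥0} {B : H →L[ℂ] H} {lam : ℝ}

theorem jumpSum_succ (hB : 0 ≤ B) (hc : ∀ ψ, quad B ψ ≤ c * quad 1 ψ) (h0 : 0 ≤ lam) (n : ℕ) :
    E.jumpSum lam (n + 1) B = (E.VFamily fun _ => B) + (lam : ℂ) • E.jump (E.jumpSum lam n B) := by
  have hV := hE.isFamily_VFamily_const hB hc
  have hQ := fun k => hE.isFamily_iterate_jump hV k
  rw [jumpSum, Finset.sum_range_succ', jumpSum,
    hE.jump_sum _ fun k => (hQ k).smul (pow_nonneg h0 k), Finset.smul_sum, add_comm]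
  congr 1
  · simp
  · refine Finset.sum_congr rfl fun k _ => ?_
    rw [hE.jump_smul (hQ k) (pow_nonneg h0 k), smul_smul, Function.iterate_succ_apply', pow_succ',
      Complex.ofReal_mul]

theorem isFamily_jumpSum (hB : 0 ≤ B) (hc : ∀ ψ, quad B ψ ≤ c * quad 1 ψ) (h0 : 0 ≤ lam)
    (h1 : lam ≤ 1) (n : ℕ) : IsFamily c (E.jumpSum lam n B) := by
  induction n with
  | zero => simpa [jumpSum] using hE.isFamily_VFamily_const hB hc
  | succ n ih =>
    rw [hE.jumpSum_succ hB hc h0]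
    exact hE.isFamily_VFamily_add_smul_jump hB hc ih h0 h1

theorem picard_eq_jumpSum (hB : 0 ≤ B) (hc : ∀ ψ, quad B ψ ≤ c * quad 1 ψ) (h0 : 0 ≤ lam)
    (n : ℕ) {s t : ℝ} (h : 0 ≤ s ∧ s ≤ t) :
    E.picard lam n s t B = E.jumpSum lam n B s t := by
  induction n generalizing t with
  | zero => simp [jumpSum, picard, VFamily, h]
  | succ n ih =>
    rw [hE.jumpSum_succ hB hc h0, Pi.add_apply, Pi.add_apply, Pi.smul_apply, Pi.smul_apply,
      VFamily, if_pos h, jump, if_pos h, picard]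
    congr 3
    funext ψ
    refine intervalIntegral.integral_congr fun u hu => ?_
    rw [uIcc_of_le h.2] at hu
    rw [ih ⟨h.1, hu.1⟩]

theorem quad_jumpSum (hB : 0 ≤ B) (hc : ∀ ψ, quad B ψ ≤ c * quad 1 ψ) (h0 : 0 ≤ lam) (n : ℕ)
    (s t : ℝ) (ψ : H) : quad (E.jumpSum lam n B s t) ψ = ∑ k ∈ Finset.range (n + 1),
      ENNReal.ofReal (lam ^ k) * quad (E.jump^[k] (E.VFamily fun _ => B) s t) ψ := by
  have hQ := fun k => (hE.isFamily_iterate_jump (hE.isFamily_VFamily_const hB hc) k)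
  rw [jumpSum, Finset.sum_apply, Finset.sum_apply,
    quad_sum _ fun k => ((hQ k).smul (pow_nonneg h0 k)).nonneg s t]
  exact Finset.sum_congr rfl fun k _ => quad_smul (pow_nonneg h0 k) _ _

theorem picard_le_Pmin (hB : 0 ≤ B) (hc : ∀ ψ, quad B ψ ≤ c * quad 1 ψ) (h0 : 0 ≤ lam)
    (h1 : lam ≤ 1) (n : ℕ) {s t : ℝ} (h : 0 ≤ s ∧ s ≤ t) :
    E.picard lam n s t B ≤ E.Pmin lam s t B := by
  have hQ := fun k => (hE.isFamily_iterate_jump (hE.isFamily_VFamily_const hB hc) k)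
  have hfam := hE.isFamily_jumpSum hB hc h0 h1
  have hex : ∃ T : H →L[ℂ] H, IsLUB (range fun n => E.picard lam n s t B) T := by
    simp only [fun n => hE.picard_eq_jumpSum hB hc h0 n h]
    refine exists_isLUB_of_monotone (fun n => (hfam n).nonneg s t)
      (monotone_nat_of_le_succ fun n => ?_) (fun n => (hfam n).quad_le s t)
    rw [jumpSum, jumpSum, Finset.sum_range_succ _ (n + 1), Pi.add_apply, Pi.add_apply]
    exact le_add_of_nonneg_right (smul_nonneg_op (pow_nonneg h0 _) ((hQ _).nonneg s t))
  rw [Pmin, dif_pos hex]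
  exact hex.choose_spec.1 ⟨n, rfl⟩

end Picard

/-! ### From bounded approximants to $\Phi_s(I)$. -/

section Convergence

omit [TopologicalSpace.SeparableSpace H] in
/-- Domination and convergence of `∫_τ^t Y_m(s, t) ds` extend from the core to all vectors. -/
theorem tendsto_lintegral_quad_of_dense {c : ℕ → ℝ≥0} {Y : ℕ → ℝ → ℝ → (H →L[ℂ] H)}
    (hY : ∀ m, IsFamily (c m) (Y m)) {R : H →L[ℂ] H} (hR : 0 ≤ R) {τ t : ℝ}
    (hle : ∀ m, ∀ ψ : E.D, ∫⁻ s in Ici τ, quad (Y m s t) ψ ≤ quad R ψ)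
    (hlim : ∀ ψ : E.D, Tendsto (fun m => ∫⁻ s in Ici τ, quad (Y m s t) ψ) atTop (𝓝 (quad R ψ)))
    (ψ : H) : (∀ m, ∫⁻ s in Ici τ, quad (Y m s t) ψ ≤ quad R ψ) ∧
      Tendsto (fun m => ∫⁻ s in Ici τ, quad (Y m s t) ψ) atTop (𝓝 (quad R ψ)) := by
  have hex : ∀ m, ∃ T : H →L[ℂ] H, 0 ≤ T ∧ ∀ ψ, quad T ψ = ∫⁻ s in Ici τ, quad (Y m s t) ψ := by
    intro m
    have hm := fun ψ => ((hY m).measurable ψ).comp (by fun_prop : Measurable fun s : ℝ => (s, t))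
    obtain ⟨T, hT0, -, -, hT⟩ := exists_integral_op (D := (⊤ : Submodule ℂ H))
      (μ := volume.restrict (Ici τ)) (c := c m * (t - τ).toNNReal) (by simp)
      (fun _ => (⊤ : Submodule ℂ H).subtype) (M := fun s => Y m s t) (fun s => (hY m).nonneg s t)
      (fun φ ψ => (measurable_inner_of_measurable_quad (fun s => (hY m).nonneg s t) hm
        φ ψ).aestronglyMeasurable)
      (fun ψ => by
        rw [(hY m).lintegral_Ici_eq]
        refine (lintegral_mono fun s => (hY m).quad_le s t _).trans_eq ?_
        rw [lintegral_const, Measure.restrict_apply_univ, Real.volume_Icc, ENNReal.coe_mul]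
        exact mul_right_comm _ _ _)
    exact ⟨T, hT0, fun ψ => hT ⟨ψ, trivial⟩⟩
  choose T hT0 hT using hex
  simp only [← hT] at hle hlim ⊢
  have hTR : ∀ m, T m ≤ R := fun m =>
    le_of_quad_le_on_dense hE.dense_D (hT0 m) hR fun ψ hψ => hle m ⟨ψ, hψ⟩
  exact ⟨fun m => quad_mono (hTR m) ψ,
    tendsto_quad_of_dense hE.dense_D hT0 hTR (fun ψ hψ => hlim ⟨ψ, hψ⟩) ψ⟩

/-- Tonelli moves the `s`-integral inside the jump; dominated convergence is then used over the
Kraus index and over `u`. The hypotheses concern all vectors because $K_k\Lambda^{1/2}W_{u,t}\psi$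
need not lie in the core. -/
theorem tendsto_lintegral_jump {c : ℕ → ℝ≥0} {Y : ℕ → ℝ → ℝ → (H →L[ℂ] H)}
    (hY : ∀ m, IsFamily (c m) (Y m)) {b : ℝ≥0} {R : ℝ → ℝ → (H →L[ℂ] H)} (hR : IsFamily b R)
    {τ : ℝ} (hle : ∀ t m ψ, ∫⁻ s in Ici τ, quad (Y m s t) ψ ≤ quad (R τ t) ψ)
    (hlim : ∀ t ψ, Tendsto (fun m => ∫⁻ s in Ici τ, quad (Y m s t) ψ) atTop (𝓝 (quad (R τ t) ψ)))
    (t : ℝ) (ψ : E.D) :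
    (∀ m, ∫⁻ s in Ici τ, quad (E.jump (Y m) s t) ψ ≤ quad (E.jump R τ t) ψ) ∧
      Tendsto (fun m => ∫⁻ s in Ici τ, quad (E.jump (Y m) s t) ψ) atTop
        (𝓝 (quad (E.jump R τ t) ψ)) := by
  have hmeas : ∀ m, Measurable fun p : ℝ × ℝ =>
      quad (E.clampA p.2 (Y m p.1 p.2)) (hE.rootW p.2 t ψ) := fun m =>
    (hE.measurable_integrand (hY m) ψ).comp
      (by fun_prop : Measurable fun p : ℝ × ℝ => ((p.1, t), p.2))
  have hswap : ∀ m, ∫⁻ s in Ici τ, quad (E.jump (Y m) s t) ψ =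
      ∫⁻ u, ∫⁻ s in Ici τ, quad (E.clampA u (Y m s u)) (hE.rootW u t ψ) := fun m => by
    simp only [fun s => hE.quad_jump (hY m) s t ψ]
    exact lintegral_lintegral_swap (hmeas m).aemeasurable
  choose K hK using fun u => hE.exists_isKraus u
  have hkr : ∀ m u, ∫⁻ s in Ici τ, quad (E.clampA u (Y m s u)) (hE.rootW u t ψ) =
      ∑' k, ∫⁻ s in Ici τ, quad (Y m s u) (K u k (hE.rootW u t ψ)) := fun m u => by
    simp only [fun s => (hK u).quad_eq ((hY m).nonneg s u)]
    exact lintegral_tsum fun k => (((hY m).measurable _).comp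
      (by fun_prop : Measurable fun s : ℝ => (s, u))).aemeasurable
  have hkR : ∀ u, quad (E.clampA u (R τ u)) (hE.rootW u t ψ) =
      ∑' k, quad (R τ u) (K u k (hE.rootW u t ψ)) := fun u =>
    (hK u).quad_eq (hR.nonneg τ u) _
  have hle' : ∀ m u, ∫⁻ s in Ici τ, quad (E.clampA u (Y m s u)) (hE.rootW u t ψ) ≤
      quad (E.clampA u (R τ u)) (hE.rootW u t ψ) := fun m u => by
    rw [hkr, hkR]
    exact ENNReal.tsum_le_tsum fun k => hle u m _
  have hlim' : ∀ u, Tendsto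
      (fun m => ∫⁻ s in Ici τ, quad (E.clampA u (Y m s u)) (hE.rootW u t ψ)) atTop
      (𝓝 (quad (E.clampA u (R τ u)) (hE.rootW u t ψ))) := fun u => by
    have hfin := quad_ne_top (E.clampA u (R τ u)) (hE.rootW u t ψ)
    rw [hkR] at hfin
    simp only [hkr, hkR, ← lintegral_count] at hfin ⊢
    exact tendsto_lintegral_of_dominated_convergence _ (fun m => measurable_of_countable _)
      (fun m => ae_of_all _ fun k => hle u m _) hfin (ae_of_all _ fun k => hlim u _)
  have hfin := quad_ne_top (E.jump R τ t) (ψ : H)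
  rw [hE.quad_jump hR] at hfin ⊢
  simp only [hswap]
  exact ⟨fun m => lintegral_mono (hle' m), tendsto_lintegral_of_dominated_convergence _
    (fun m => (hmeas m).lintegral_prod_left') (fun m => ae_of_all _ (hle' m)) hfin
    (ae_of_all _ hlim')⟩

/-- The identity $\int_\tau^tV_{s,t}\Phi_s(I)\,ds=J(I)_{\tau,t}$, reached through approximants:
$W_{s,t}\psi$ stays in the core, where their forms converge. -/
theorem tendsto_lintegral_VFamily {X : ℕ → ℝ → H →L[ℂ] H}
    (hV : ∀ m, ∃ c, IsFamily c (E.VFamily (X m)))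
    (hle : ∀ m s, ∀ φ ∈ E.D, quad (X m s) φ ≤ quad (E.clampA s 1) (pApply E.rootΛ φ))
    (hlim : ∀ s, ∀ φ ∈ E.D, Tendsto (fun m => quad (X m s) φ) atTop
      (𝓝 (quad (E.clampA s 1) (pApply E.rootΛ φ)))) {τ : ℝ} (hτ : 0 ≤ τ) (t : ℝ) (ψ : E.D) :
    (∀ m, ∫⁻ s in Ici τ, quad (E.VFamily (X m) s t) ψ ≤ quad (E.jump oneFamily τ t) ψ) ∧
      Tendsto (fun m => ∫⁻ s in Ici τ, quad (E.VFamily (X m) s t) ψ) atTop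
        (𝓝 (quad (E.jump oneFamily τ t) ψ)) := by
  have hfin := quad_ne_top (E.jump oneFamily τ t) (ψ : H)
  rw [hE.quad_jump isFamily_oneFamily] at hfin ⊢
  simp only [← lintegral_indicator measurableSet_Ici]
  have key : ∀ s, (∀ m, (Ici τ).indicator (fun s => quad (E.VFamily (X m) s t) (ψ : H)) s ≤
      quad (E.clampA s (oneFamily τ s)) (hE.rootW s t ψ)) ∧
      Tendsto (fun m => (Ici τ).indicator (fun s => quad (E.VFamily (X m) s t) (ψ : H)) s) atTop
        (𝓝 (quad (E.clampA s (oneFamily τ s)) (hE.rootW s t ψ))) := by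
    intro s
    by_cases hs : τ ≤ s
    · simp only [indicator_of_mem (mem_Ici.2 hs)]
      rw [oneFamily, if_pos ⟨hτ, hs⟩]
      by_cases hst : 0 ≤ s ∧ s ≤ t
      · simp only [VFamily, if_pos hst, quad_V]
        rw [hE.rootW_of_mem hst]
        exact ⟨fun m => hle m s _ (hE.W_mem hst ψ), hlim s _ (hE.W_mem hst ψ)⟩
      · simp only [VFamily, if_neg hst, quad_zero]
        rw [hE.rootW_of_not_mem hst, quad_apply_zero]
        exact ⟨fun m => le_rfl, tendsto_const_nhds⟩
    · simp only [indicator_of_notMem (fun h : s ∈ Ici τ => hs (mem_Ici.1 h))]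
      rw [oneFamily, if_neg fun h => hs h.2, map_zero, quad_zero]
      exact ⟨fun m => le_rfl, tendsto_const_nhds⟩
  refine ⟨fun m => lintegral_mono fun s => (key s).1 m,
    tendsto_lintegral_of_dominated_convergence _ (fun m => ?_)
      (fun m => ae_of_all _ fun s => (key s).1 m) hfin (ae_of_all _ fun s => (key s).2)⟩
  obtain ⟨c, hc⟩ := hV m
  exact ((hc.measurable ψ).comp (by fun_prop : Measurable fun s : ℝ => (s, t))).indicator
    measurableSet_Ici

theorem tendsto_lintegral_iterate_jump {c : ℕ → ℝ≥0} {X : ℕ → ℝ → H →L[ℂ] H}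
    (hV : ∀ m, IsFamily (c m) (E.VFamily (X m)))
    (hle : ∀ m s, ∀ φ ∈ E.D, quad (X m s) φ ≤ quad (E.clampA s 1) (pApply E.rootΛ φ))
    (hlim : ∀ s, ∀ φ ∈ E.D, Tendsto (fun m => quad (X m s) φ) atTop
      (𝓝 (quad (E.clampA s 1) (pApply E.rootΛ φ)))) {τ : ℝ} (hτ : 0 ≤ τ) (n : ℕ) (t : ℝ) (ψ : H) :
    (∀ m, ∫⁻ s in Ici τ, quad (E.jump^[n] (E.VFamily (X m)) s t) ψ ≤
        quad (E.jump^[n + 1] oneFamily τ t) ψ) ∧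
      Tendsto (fun m => ∫⁻ s in Ici τ, quad (E.jump^[n] (E.VFamily (X m)) s t) ψ) atTop
        (𝓝 (quad (E.jump^[n + 1] oneFamily τ t) ψ)) := by
  induction n generalizing t ψ with
  | zero =>
    have h := hE.tendsto_lintegral_VFamily (fun m => ⟨_, hV m⟩) hle hlim hτ t
    exact hE.tendsto_lintegral_quad_of_dense hV (hE.jump_nonneg isFamily_oneFamily τ t)
      (fun m ψ => (h ψ).1 m) (fun ψ => (h ψ).2) ψ
  | succ n ih =>
    have hQ := fun m => hE.isFamily_iterate_jump (hV m) n
    have hR := hE.isFamily_iterate_jump (isFamily_oneFamily (H := H)) (n + 1)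
    have h := hE.tendsto_lintegral_jump hQ hR (fun t m ψ => (ih t ψ).1 m)
      (fun t ψ => (ih t ψ).2) t
    simp only [Function.iterate_succ_apply' _ n (E.VFamily _),
      Function.iterate_succ_apply' _ (n + 1) oneFamily]
    exact hE.tendsto_lintegral_quad_of_dense (fun m => hE.isFamily_jump (hQ m))
      (hE.jump_nonneg hR τ t) (fun m ψ => (h ψ).1 m) (fun ψ => (h ψ).2) ψ

end Convergence

/-! ### Divergence of the harmonic series and unitality. -/

section Unital

/-- The operator `X` competes in the supremum defining `PminΦ`, and the finite sum is a Picard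
iterate below `Pmin`. -/
theorem sum_quad_iterate_jump_le_PminΦ {c : ℝ≥0} {X : H →L[ℂ] H} (hX : 0 ≤ X)
    (hc : ∀ ψ, quad X ψ ≤ c * quad 1 ψ) {s t : ℝ} (h : 0 ≤ s ∧ s ≤ t)
    (hle : ∀ φ ∈ E.D, quad X φ ≤ quad (E.clampA s 1) (pApply E.rootΛ φ)) {lam : ℝ}
    (h0 : 0 ≤ lam) (h1 : lam ≤ 1) (n : ℕ) (ψ : H) :
    ∑ k ∈ Finset.range (n + 1),
      ENNReal.ofReal (lam ^ k) * quad (E.jump^[k] (E.VFamily fun _ => X) s t) ψ ≤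
      E.PminΦ lam s t ψ := by
  rw [← hE.quad_jumpSum hX hc h0, ← hE.picard_eq_jumpSum hX hc h0 n h]
  refine (quad_mono (hE.picard_le_Pmin hX hc h0 h1 n h) ψ).trans ?_
  refine le_iSup₂_of_le X hX (le_iSup_of_le (fun φ hφ => ?_) le_rfl)
  have := (ENNReal.ofReal_le_ofReal_iff
    (re_inner_nonneg (hE.clampA_nonneg s one_nonneg_op) _)).1 (hle φ hφ)
  rwa [E.clampA_of_nonneg h.1] at this

theorem sum_quad_iterate_jump_le_Chat {τ t : ℝ} (hτ : 0 ≤ τ) (n : ℕ) (ψ : H) :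
    ∑ k ∈ Finset.range (n + 1),
      ENNReal.ofReal (1 / (k + 1 : ℝ)) * quad (E.jump^[k + 1] oneFamily τ t) ψ ≤
      E.Chat τ t ψ := by
  obtain ⟨X, hX0, hXc, hXm, hXle, hXlim⟩ := hE.exists_approximants
  have hV := fun m => hE.isFamily_VFamily (hX0 m) (hXc m) (hXm m)
  have hconv := fun k => (hE.tendsto_lintegral_iterate_jump hV hXle hXlim hτ k t ψ).2
  refine le_of_tendsto (tendsto_finsetSum _ fun k _ =>
    ENNReal.Tendsto.const_mul (hconv k) (Or.inr ENNReal.ofReal_ne_top))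
    (Eventually.of_forall fun m => ?_)
  have hQ := fun k => hE.isFamily_iterate_jump (hV m) k
  have hQm : ∀ k, Measurable fun s => quad (E.jump^[k] (E.VFamily (X m)) s t) ψ := fun k =>
    ((hQ k).measurable ψ).comp (by fun_prop : Measurable fun s : ℝ => (s, t))
  calc _ = ∑ k ∈ Finset.range (n + 1), ∫⁻ lam in Ioc (0 : ℝ) 1, ENNReal.ofReal (lam ^ k) *
          ∫⁻ s in Icc τ t, quad (E.jump^[k] (E.VFamily (X m)) s t) ψ := by
        refine Finset.sum_congr rfl fun k _ => ?_
        rw [lintegral_mul_const _ (by fun_prop), lintegral_Ioc_zero_one_pow,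
          (hQ k).lintegral_Ici_eq]
    _ = ∫⁻ lam in Ioc (0 : ℝ) 1, ∑ k ∈ Finset.range (n + 1), ENNReal.ofReal (lam ^ k) *
          ∫⁻ s in Icc τ t, quad (E.jump^[k] (E.VFamily (X m)) s t) ψ := by
        rw [lintegral_finsetSum _ fun k _ => by fun_prop]
    _ = ∫⁻ lam in Ioc (0 : ℝ) 1, ∫⁻ s in Icc τ t, ∑ k ∈ Finset.range (n + 1),
          ENNReal.ofReal (lam ^ k) * quad (E.jump^[k] (E.VFamily (X m)) s t) ψ := by
        refine lintegral_congr fun lam => ?_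
        rw [lintegral_finsetSum _ fun k _ => (hQm k).const_mul _]
        exact Finset.sum_congr rfl fun k _ => (lintegral_const_mul _ (hQm k)).symm
    _ ≤ E.Chat τ t ψ := by
        -- Monotonicity of the lower integral asks nothing of the larger integrand, so measurability
        -- of `PminΦ` is not needed.
        refine setLIntegral_mono' measurableSet_Ioc fun lam hlam =>
          setLIntegral_mono' measurableSet_Icc fun s hs => ?_
        have hst : 0 ≤ s ∧ s ≤ t := ⟨hτ.trans hs.1, hs.2⟩
        refine le_trans (le_of_eq (Finset.sum_congr rfl fun k _ => ?_))
          (hE.sum_quad_iterate_jump_le_PminΦ (hX0 m s) (hXc m s) hst (hXle m s) hlam.1.le hlam.2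
            n ψ)
        rw [iterate_jump_congr (Y := E.VFamily (X m)) (Z := E.VFamily fun _ => X m s) fun u => rfl]

theorem antitone_quad_iterate_jump (s t : ℝ) (ψ : H) :
    Antitone fun n => quad (E.jump^[n] oneFamily s t) ψ :=
  antitone_nat_of_succ_le fun n => by
    rw [hE.iterate_jump_oneFamily n, Pi.add_apply, Pi.add_apply,
      quad_add ((hE.isFamily_iterate_jump hE.isFamily_VFamily_one n).nonneg s t)
        ((hE.isFamily_iterate_jump isFamily_oneFamily (n + 1)).nonneg s t)]
    exact le_add_self

theorem tendsto_quad_iterate_jump {τ t : ℝ} (hτ : 0 ≤ τ) {ψ : H} (hψ : E.Chat τ t ψ < ⊤) :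
    Tendsto (fun n => quad (E.jump^[n] oneFamily τ t) ψ) atTop (𝓝 0) := by
  have hanti := hE.antitone_quad_iterate_jump τ t ψ
  have hlim := tendsto_atTop_iInf hanti
  set δ := ⨅ n, quad (E.jump^[n] oneFamily τ t) ψ
  have hbd : ∀ n, ENNReal.ofReal (∑ k ∈ Finset.range (n + 1), 1 / (k + 1 : ℝ)) * δ ≤
      E.Chat τ t ψ := fun n => by
    refine le_trans ?_ (hE.sum_quad_iterate_jump_le_Chat hτ n ψ)
    rw [ENNReal.ofReal_sum_of_nonneg fun k _ => by positivity, Finset.sum_mul]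
    gcongr with k hk
    -- Each $R_{k+1}[\psi]$ is at least the infimum `δ`, so harmonic sums times `δ` stay below
    -- $\widehat C[\psi]$.
    exact iInf_le _ (k + 1)
  by_contra hne
  have hδ : δ ≠ 0 := fun h => hne (h ▸ hlim)
  have h1 : Tendsto (fun n : ℕ => ENNReal.ofReal (∑ k ∈ Finset.range (n + 1), 1 / (k + 1 : ℝ)) * δ)
      atTop (𝓝 (⊤ * δ)) :=
    ENNReal.Tendsto.mul_const (ENNReal.tendsto_ofReal_atTop.comp
      (Real.tendsto_sum_range_one_div_nat_succ_atTop.comp (tendsto_add_atTop_nat 1)))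
      (Or.inl ENNReal.top_ne_zero)
  have h2 := le_of_tendsto' h1 hbd
  rw [ENNReal.top_mul hδ] at h2
  exact hψ.not_ge h2

theorem picard_one_add_iterate_jump {s t : ℝ} (h : 0 ≤ s ∧ s ≤ t) (n : ℕ) :
    E.picard 1 n s t 1 + E.jump^[n + 1] oneFamily s t = 1 := by
  rw [hE.picard_eq_jumpSum (c := 1) one_nonneg_op (fun ψ => by simp) zero_le_one n h, jumpSum]
  have := congrFun (congrFun (hE.sum_iterate_jump_add (n + 1)) s) t
  rw [oneFamily, if_pos h] at this
  simpa using this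

theorem Pmin_one_eq_one {τ t : ℝ} (h : 0 ≤ τ ∧ τ ≤ t) (hC : Dense {ψ : H | E.Chat τ t ψ < ⊤}) :
    E.Pmin 1 τ t 1 = 1 := by
  have hR := fun n => (hE.isFamily_iterate_jump (isFamily_oneFamily (H := H)) n).nonneg τ t
  have hadd := hE.picard_one_add_iterate_jump h
  have hP : ∀ n, 0 ≤ E.picard 1 n τ t 1 := fun n => by
    rw [hE.picard_eq_jumpSum (c := 1) one_nonneg_op (fun ψ => by simp) zero_le_one n h]
    exact (hE.isFamily_jumpSum (c := 1) one_nonneg_op (fun ψ => by simp) zero_le_one le_rfl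
      n).nonneg τ t
  have hlub : IsLUB (range fun n => E.picard 1 n τ t 1) 1 := by
    refine ⟨?_, fun S hS => ?_⟩
    · rintro _ ⟨n, rfl⟩
      exact (le_add_of_nonneg_right (hR (n + 1))).trans_eq (hadd n)
    -- An upper bound `S` satisfies $I\le S+R_{n+1}$ for every $n$; letting $n\to\infty$ on the
    -- dense set where $\widehat C$ is finite gives $I\le S$.
    · refine le_of_quad_le_on_dense hC one_nonneg_op ((hP 0).trans (hS ⟨0, rfl⟩)) fun ψ hψ => ?_
      have hlim := (hE.tendsto_quad_iterate_jump h.1 hψ).comp (tendsto_add_atTop_nat 1)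
      have hlim' := (tendsto_const_nhds (x := quad S ψ)).add hlim
      rw [add_zero] at hlim'
      refine ge_of_tendsto hlim' (Eventually.of_forall fun n => ?_)
      have : quad 1 ψ = _ := congrArg (quad · ψ) (hadd n).symm
      rw [this, quad_add (hP n) (hR (n + 1))]
      exact add_le_add (quad_mono (hS ⟨n, rfl⟩) ψ) le_rfl
  have hex : ∃ T : H →L[ℂ] H, IsLUB (range fun n => E.picard 1 n τ t 1) T := ⟨1, hlub⟩
  rw [Pmin, dif_pos hex]
  exact hex.choose_spec.unique hlub

end Unital

end DomainContinuity

end Coefficients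

end MasterEquation

end

theorem theorem1p2 {H : Type*} [NormedAddCommGroup H] [InnerProductSpace ℂ H] [CompleteSpace H]
    [TopologicalSpace.SeparableSpace H] (E : MasterEquation.Coefficients H)
    (hE : E.DomainContinuity) (τ t : ℝ) (hτ : 0 ≤ τ) (hτt : τ ≤ t)
    (hC : Dense {ψ : H | E.Chat τ t ψ < ⊤}) :
    E.Pmin 1 τ t 1 = 1 :=
  hE.Pmin_one_eq_one ⟨hτ, hτt⟩ hC
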